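/- Let $e^1,\dots,e^N$ be the standard basis of $\mathbb{R}^N$, let $\langle\cdot,\cdot\rangle$ be the standard inner product, extended $\mathbb{C}$-bilinearly to $V=\mathbb{C}^N$, and identify a vector $\beta$ with the linear function $\beta(x)=\langle\beta,x\rangle$. Let $\mathcal{R}\subset\mathbb{R}^N$ be one of the reduced non-simply-laced root systems listed below, with simple roots $\alpha_1,\dots,\alpha_N$, positive roots $\mathcal{R}^+$ and highest root $\theta=\sum_{i=1}^N n_i\alpha_i$ (so that $m_i\le n_i$ for all $i$ whenever $\sum_i m_i\alpha_i\in\mathcal{R}$). For $p,q\in\mathbb{C}$ let $c_\beta=p$ if $\beta$ is a short root and $c_\beta=q$ if $\beta$ is a long root. For $\widetilde\gamma\in\mathbb{C}\setminus\{0\}$ consider (a) the commutative bilinear multiplication on $V\oplus\mathbb{C}E$ with identity $E$ which, at a point $x\in V$ with $\sinh\beta(x)\ne0$ for all $\beta\in\mathcal{R}$, is given by $$u*v=\langle u,v\rangle E+\widetilde\gamma^{-1}\sum_{\beta\in\mathcal{R}^+}\frac{c_\beta}{\langle\beta,\beta\rangle}\,\beta(u)\beta(v)\coth(\beta(x))\,\beta\qquad(u,v\in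 V);$$ (b) the function of $(x,y)=(x_1,\dots,x_N,x_{N+1})\in V\oplus\mathbb{C}$ $$\widetilde F(x,y)=\frac{\widetilde\gamma}{6}y^3+\frac{\widetilde\gamma}{2}\,y\,\langle x,x\rangle+\sum_{\beta\in\mathcal{R}^+}\frac{c_\beta}{\langle\beta,\beta\rangle}\,\widetilde f(\beta(x)),\qquad \widetilde f(z)=\tfrac16z^3-\tfrac14\mathrm{Li}_3(e^{-2z}),$$ on the open set where $\operatorname{Re}\beta(x)>0$ for all $\beta\in\mathcal{R}^+$ (here $\mathrm{Li}_3(w)=\sum_{k\ge1}w^k/k^3$ and $\widetilde f'''(z)=\coth z$). It satisfies the WDVV equations if, at every point of this set, $F_{N+1}$ is invertible and $F_iF_{N+1}^{-1}F_j=F_jF_{N+1}^{-1}F_i$ for $1\le i,j\le N$, where $F_i$ is the $(N+1)\times(N+1)$ matrix $\big(\partial^3\widetilde F/\partial x_i\partial x_k\partial x_l\big)_{k,l}$. Then, for every $\widetilde\gamma\ne0$, the multiplication (a) is associative at all such points $x$ if and only if $$\widetilde\gamma^2=-\frac18\Big(a_0\langle\theta,\theta\rangle+\sum_{i=1}^N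 a_in_i^2\langle\alpha_i,\alpha_i\rangle\Big),$$ and $\widetilde F$ satisfies the WDVV equations if and only if the same equality holds, where the coefficients $a_i$ are as follows. 1. $\mathcal{R}=B_N=\{\pm e^i\}\cup\{\pm e^i\pm e^j: i<j\}$, $N\ge2$, with $\alpha_i=e^i-e^{i+1}$ $(1\le i\le N-1)$, $\alpha_N=e^N$: $a_0=a_1=a_N=pq$ and $a_i=q^2$ for $2\le i\le N-1$. 2. $\mathcal{R}=C_N=\{\pm 2e^i\}\cup\{\pm e^i\pm e^j: i<j\}$, $N\ge2$, with $\alpha_i=e^i-e^{i+1}$ $(1\le i\le N-1)$, $\alpha_N=2e^N$: $a_0=a_1=a_N=pq$ and $a_i=p^2$ for $2\le i\le N-1$. 3. $\mathcal{R}=F_4=\{\pm e^i\}\cup\{\pm e^i\pm e^j: i<j\}\cup\{\tfrac12(\pm e^1\pm e^2\pm e^3\pm e^4)\}$, $N=4$, with $\alpha_1=e^2-e^3$, $\alpha_2=e^3-e^4$, $\alpha_3=e^4$, $\alpha_4=\tfrac12(e^1-e^2-e^3-e^4)$: $a_0=a_2=a_4=pq$, $a_1=p^2$, $a_3=q^2$.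 4. $\mathcal{R}=G_2=\{\pm\sqrt3e^1,\ \pm(\tfrac{\sqrt3}2e^1\pm\tfrac32e^2),\ \pm e^2,\ \pm(\tfrac{\sqrt3}2e^1\pm\tfrac12e^2)\}$, $N=2$, with $\alpha_1=\tfrac{\sqrt3}2e^1-\tfrac32e^2$, $\alpha_2=e^2$: $a_0=p^2$, $a_1=pq$, $a_2=q^2$. -/

import Mathlib

open scoped Matrix

noncomputable section

namespace TrigWDVV

/-! ### Root systems and multiplicities

A root is a real coordinate vector `β : Fin N → ℝ` with respect to the standard orthonormal
basis; the invariant inner product is the standard dot product `⬝ᵥ`, and it is extended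
complex-bilinearly to `Fin N → ℂ`. -/

/-- The standard basis vector `e^i`. -/
def e {N : ℕ} (i : Fin N) : Fin N → ℝ := Pi.single i 1

open Classical in
/-- The set `S ∪ (-S)`. -/
def withNeg {N : ℕ} (S : Finset (Fin N → ℝ)) : Finset (Fin N → ℝ) :=
  S ∪ S.image (fun v => -v)

open Classical in
/-- The vectors `e^i + e^j` and `e^i - e^j` with `i < j`. -/
def pairVectors (N : ℕ) : Finset (Fin N → ℝ) :=
  ((Finset.univ : Finset (Fin N × Fin N)).filter (fun ij => ij.1 < ij.2)).image
      (fun ij => e ij.1 + e ij.2) ∪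
    ((Finset.univ : Finset (Fin N × Fin N)).filter (fun ij => ij.1 < ij.2)).image
      (fun ij => e ij.1 - e ij.2)

open Classical in
/-- The root system `B_N`: the vectors `±e^i` and `±e^i ± e^j`, `i < j`. -/
def rootsB (N : ℕ) : Finset (Fin N → ℝ) :=
  withNeg (Finset.univ.image (fun i : Fin N => e i) ∪ pairVectors N)

/-- Simple roots of `B_N`: `e^i - e^{i+1}` for `i < N`, and `e^N`. -/
def simpleB (N : ℕ) (i : Fin N) : Fin N → ℝ :=
  if h : i.val + 1 < N then e i - e ⟨i.val + 1, h⟩ else e i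

open Classical in
/-- The root system `C_N`: the vectors `±2e^i` and `±e^i ± e^j`, `i < j`. -/
def rootsC (N : ℕ) : Finset (Fin N → ℝ) :=
  withNeg (Finset.univ.image (fun i : Fin N => (2 : ℝ) • e i) ∪ pairVectors N)

/-- Simple roots of `C_N`: `e^i - e^{i+1}` for `i < N`, and `2e^N`. -/
def simpleC (N : ℕ) (i : Fin N) : Fin N → ℝ :=
  if h : i.val + 1 < N then e i - e ⟨i.val + 1, h⟩ else (2 : ℝ) • e i

open Classical in
/-- The root system `F_4`: the vectors `±e^i`, `±e^i ± e^j` for `i < j`, and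
`(±e^1 ± e^2 ± e^3 ± e^4)/2`. -/
def rootsF4 : Finset (Fin 4 → ℝ) :=
  rootsB 4 ∪ Fintype.piFinset (fun _ : Fin 4 => ({1 / 2, -(1 / 2)} : Finset ℝ))

/-- Simple roots of `F_4`: `e^2 - e^3`, `e^3 - e^4`, `e^4`, `(e^1 - e^2 - e^3 - e^4)/2`. -/
def simpleF4 : Fin 4 → (Fin 4 → ℝ) :=
  ![![0, 1, -1, 0], ![0, 0, 1, -1], ![0, 0, 0, 1],
    ![1 / 2, -(1 / 2), -(1 / 2), -(1 / 2)]]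

open Classical in
/-- The root system `G_2` in the plane: up to sign, the long roots are `√3 e^1` and
`(√3/2) e^1 ± (3/2) e^2`, the short ones `e^2` and `(√3/2) e^1 ± (1/2) e^2`. -/
def rootsG2 : Finset (Fin 2 → ℝ) :=
  withNeg {![√3, 0], ![√3 / 2, 3 / 2], ![√3 / 2, -(3 / 2)],
    ![0, 1], ![√3 / 2, 1 / 2], ![√3 / 2, -(1 / 2)]}

/-- Simple roots of `G_2`: `(√3/2) e^1 - (3/2) e^2` and `e^2`. -/
def simpleG2 : Fin 2 → (Fin 2 → ℝ) :=
  ![![√3 / 2, -(3 / 2)], ![0, 1]]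

open Classical in
/-- The positive roots with respect to the simple roots `α`: those roots that are combinations
of the simple roots with non-negative integer coefficients. -/
def posRoots {N : ℕ} (R : Finset (Fin N → ℝ)) (α : Fin N → (Fin N → ℝ)) :
    Finset (Fin N → ℝ) :=
  R.filter (fun β => ∃ m : Fin N → ℕ, β = ∑ i, (m i : ℝ) • α i)

/-- `n` is the coefficient vector of the highest root: `∑ n_i α_i` is a root, and
`m_i ≤ n_i` for all `i` whenever `∑ m_i α_i` is a root. -/
def IsHighest {N : ℕ} (R : Finset (Fin N → ℝ)) (α : Fin N → (Fin N → ℝ)) (n : Fin N → ℤ) :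
    Prop :=
  (∑ i, (n i : ℝ) • α i) ∈ R ∧
    ∀ m : Fin N → ℤ, (∑ i, (m i : ℝ) • α i) ∈ R → ∀ i, m i ≤ n i

open Classical in
/-- The multiplicity function on `R` with value `p` on the short roots (those of minimal length)
and `q` on the others, the long roots. -/
def mult {N : ℕ} (R : Finset (Fin N → ℝ)) (p q : ℂ) (β : Fin N → ℝ) : ℂ :=
  if ∀ δ ∈ R, β ⬝ᵥ β ≤ δ ⬝ᵥ δ then p else q

/-- The weight `d_β = c_β / ⟨β, β⟩`. -/
def weight {N : ℕ} (R : Finset (Fin N → ℝ)) (p q : ℂ) (β : Fin N → ℝ) : ℂ :=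
  mult R p q β / ((β ⬝ᵥ β : ℝ) : ℂ)

/-- A root as a vector of the complexified space. -/
def cvec {N : ℕ} (β : Fin N → ℝ) : Fin N → ℂ := fun i => (β i : ℂ)

/-- The root as a linear function `β(x) = ⟨β, x⟩` on the complexified space. -/
def pair {N : ℕ} (β : Fin N → ℝ) (x : Fin N → ℂ) : ℂ := cvec β ⬝ᵥ x

/-! ### The multiplication on `V ⊕ U` -/

/-- The hyperbolic cotangent. -/
def coth (z : ℂ) : ℂ := Complex.cosh z / Complex.sinh z

/-- The component of `u * v` in `V`, for `u, v ∈ V`: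
`γ⁻¹ ∑_{β > 0} d_β β(u) β(v) coth(β(x)) β`. -/
def prodV {N : ℕ} (R : Finset (Fin N → ℝ)) (α : Fin N → (Fin N → ℝ)) (p q γ : ℂ)
    (x u v : Fin N → ℂ) : Fin N → ℂ :=
  γ⁻¹ • ∑ β ∈ posRoots R α,
    (weight R p q β * pair β u * pair β v * coth (pair β x)) • cvec β

/-- The bilinear multiplication on `V ⊕ U`, `U = ℂ E`, at the point `x`: the vector `E = (0, 1)`
is the identity and `u * v = ⟨u, v⟩ E + prodV x u v` for `u, v ∈ V`. -/
def mul {N : ℕ} (R : Finset (Fin N → ℝ)) (α : Fin N → (Fin N → ℝ)) (p q γ : ℂ)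
    (x : Fin N → ℂ) (X Y : (Fin N → ℂ) × ℂ) : (Fin N → ℂ) × ℂ :=
  (prodV R α p q γ x X.1 Y.1 + X.2 • Y.1 + Y.2 • X.1, X.1 ⬝ᵥ Y.1 + X.2 * Y.2)

/-- The multiplication is associative at every point `x` of the complexified space at which all
the functions `coth(β(x))` are defined. -/
def IsAssociativeMul {N : ℕ} (R : Finset (Fin N → ℝ)) (α : Fin N → (Fin N → ℝ))
    (p q γ : ℂ) : Prop :=
  ∀ x : Fin N → ℂ, (∀ β ∈ R, Complex.sinh (pair β x) ≠ 0) →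
    ∀ X Y Z : (Fin N → ℂ) × ℂ,
      mul R α p q γ x (mul R α p q γ x X Y) Z = mul R α p q γ x X (mul R α p q γ x Y Z)

/-! ### The prepotential and the WDVV equations -/

/-- The trilogarithm `∑_{k ≥ 1} w^k / k^3`, used for `|w| < 1` only. -/
def Li3 (w : ℂ) : ℂ := ∑' k : ℕ, w ^ (k + 1) / ((k : ℂ) + 1) ^ 3

/-- The function `z^3/6 - Li_3(e^{-2z})/4`, whose third derivative is `coth z`. -/
def fTilde (z : ℂ) : ℂ := z ^ 3 / 6 - Li3 (Complex.exp (-2 * z)) / 4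

/-- The `V`-component `x = (z_1, …, z_N)` of `z ∈ V ⊕ U`. -/
def xPart {N : ℕ} (z : Fin (N + 1) → ℂ) : Fin N → ℂ := fun i => z i.castSucc

/-- The prepotential, a function of `z = (x_1, …, x_N, y)`:
`(γ/6) y^3 + (γ/2) y ⟨x, x⟩ + ∑_{β > 0} d_β fTilde(β(x))`. -/
def prepotential {N : ℕ} (R : Finset (Fin N → ℝ)) (α : Fin N → (Fin N → ℝ)) (p q γ : ℂ)
    (z : Fin (N + 1) → ℂ) : ℂ :=
  γ / 6 * z (Fin.last N) ^ 3 + γ / 2 * z (Fin.last N) * (xPart z ⬝ᵥ xPart z) +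
    ∑ β ∈ posRoots R α, weight R p q β * fTilde (pair β (xPart z))

/-- The complex partial derivative `∂F/∂z_i`. -/
def partialDeriv {n : ℕ} (i : Fin n) (F : (Fin n → ℂ) → ℂ) : (Fin n → ℂ) → ℂ :=
  fun z => fderiv ℂ F z (Pi.single i 1)

/-- The matrix `F_i = (∂^3 F / ∂z_i ∂z_j ∂z_k)_{j,k}` of third derivatives at `z`. -/
def thirdDerivMatrix {n : ℕ} (F : (Fin n → ℂ) → ℂ) (i : Fin n) (z : Fin n → ℂ) :
    Matrix (Fin n) (Fin n) ℂ :=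
  Matrix.of fun j k => partialDeriv i (partialDeriv j (partialDeriv k F)) z

/-- The WDVV equations `F_i F_{N+1}⁻¹ F_j = F_j F_{N+1}⁻¹ F_i`, `1 ≤ i, j ≤ N`, at all points of
`D`, where `F_{N+1}` is required to be invertible. -/
def SatisfiesWDVV {N : ℕ} (F : (Fin (N + 1) → ℂ) → ℂ) (D : Set (Fin (N + 1) → ℂ)) : Prop :=
  ∀ z ∈ D, IsUnit (thirdDerivMatrix F (Fin.last N) z) ∧
    ∀ i j : Fin N,
      thirdDerivMatrix F i.castSucc z * (thirdDerivMatrix F (Fin.last N) z)⁻¹ *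
          thirdDerivMatrix F j.castSucc z =
        thirdDerivMatrix F j.castSucc z * (thirdDerivMatrix F (Fin.last N) z)⁻¹ *
          thirdDerivMatrix F i.castSucc z

/-- The open set of all `z = (x, y)` with `Re β(x) > 0` for every positive root `β`; there
`|e^{-2β(x)}| < 1`, so the prepotential is given by convergent power series. -/
def chamberTube {N : ℕ} (R : Finset (Fin N → ℝ)) (α : Fin N → (Fin N → ℝ)) :
    Set (Fin (N + 1) → ℂ) :=
  {z | ∀ β ∈ posRoots R α, 0 < (pair β (xPart z)).re}

/-! ### The formula for the constant -/

/-- The number `-(1/8) (a₀ ⟨θ, θ⟩ + ∑ a_i n_i² ⟨α_i, α_i⟩)`, where `θ = ∑ n_i α_i`. -/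
def gammaSq {N : ℕ} (α : Fin N → (Fin N → ℝ)) (n : Fin N → ℤ) (a₀ : ℂ) (a : Fin N → ℂ) : ℂ :=
  -(1 / 8) * (a₀ * (cvec (∑ i, (n i : ℝ) • α i) ⬝ᵥ cvec (∑ i, (n i : ℝ) • α i)) +
    ∑ i, a i * (n i : ℂ) ^ 2 * (cvec (α i) ⬝ᵥ cvec (α i)))

/-- The highest root `∑ n_i α_i` exists, and the non-zero constants `γ` for which the
multiplication is associative, and those for which the prepotential solves the WDVV equations,
are in both cases exactly those whose square is `gammaSq`. -/
def GammaFormula {N : ℕ} (R : Finset (Fin N → ℝ)) (α : Fin N → (Fin N → ℝ)) (p q : ℂ)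
    (a₀ : ℂ) (a : Fin N → ℂ) : Prop :=
  (∃ n : Fin N → ℤ, IsHighest R α n) ∧
    ∀ n : Fin N → ℤ, IsHighest R α n → ∀ γ : ℂ, γ ≠ 0 →
      (IsAssociativeMul R α p q γ ↔ γ ^ 2 = gammaSq α n a₀ a) ∧
      (SatisfiesWDVV (prepotential R α p q γ) (chamberTube R α) ↔ γ ^ 2 = gammaSq α n a₀ a)

end TrigWDVV

end

/-! Put M_u = ∑_{β>0} d_β β(u) coth β(x) β⊗β. Everything reduces to one identity, `HasCurvature`: at
each regular x, [M_u, M_w] = K (u⊗w − w⊗u) with a constant K independent of x. It says that the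
associator of the V-part of the product is that of a constant-curvature tensor.

Given the identity, the V-component of u*(v*w) − (u*v)*w is (γ⁻²K + 1)(⟨v,w⟩u − ⟨u,v⟩w), so for N ≥
2 associativity at a single regular point already forces γ² = −K, and γ² = −K gives it at all of
them. For the prepotential, F_{N+1} = γ·1, so WDVV means [F_i, F_j] = 0. The matrix F_i is M_{e_i}
bordered by γ e_i, and the border adds γ²(E_ij − E_ji) to the commutator, giving again K + γ² = 0.
`gammaFormula_of_hasCurvature` packages this together with the recognition of the positive and
highest roots; what remains is to find K and to check that 8K is the stated combination.

The identity itself comes from the addition theorem coth(a+b)(coth a + coth b) = 1 + coth a coth b.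
The (a,b) entry of [M_i, M_j] is a sum over unordered pairs of positive roots of d_β d_δ ⟨β,δ⟩ coth
β coth δ times the (i,j) and (a,b) minors of (β,δ). Triples β, δ, β+δ in a common plane share their
minors up to sign, and the addition theorem turns their products into constants.

For B_N and C_N the variables t_a = cosh 2x_a turn the needed relations into divided differences of
polynomials (`hasCurvature_halfRoots`). For F_4, antisymmetry and permutations of the coordinates
leave three entries, each an explicit combination of addition theorems. For G_2 a single entry
remains. -/

open scoped Matrix

noncomputable section

namespace TrigWDVV

/-! ### Polylogarithms and the derivatives of `fTilde`. -/

/-- The series `∑_{k ≥ 1} w^k / k^s`. -/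
def polylog (s : ℕ) (w : ℂ) : ℂ := ∑' k : ℕ, w ^ (k + 1) / ((k : ℂ) + 1) ^ s

theorem norm_polylog_term_le (s : ℕ) {w : ℂ} {r : ℝ} (hw : ‖w‖ ≤ r) (k : ℕ) :
    ‖w ^ (k + 1) / ((k : ℂ) + 1) ^ s‖ ≤ r ^ (k + 1) := by
  have h1 : (1 : ℝ) ≤ ‖((k : ℂ) + 1) ^ s‖ := by
    rw [norm_pow]
    apply one_le_pow₀
    rw [show ((k : ℂ) + 1) = ((k + 1 : ℕ) : ℂ) by push_cast; ring, Complex.norm_natCast]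
    push_cast
    linarith [(Nat.cast_nonneg k : (0 : ℝ) ≤ k)]
  rw [norm_div, norm_pow]
  calc ‖w‖ ^ (k + 1) / ‖((k : ℂ) + 1) ^ s‖ ≤ ‖w‖ ^ (k + 1) := div_le_self (by positivity) h1
    _ ≤ r ^ (k + 1) := by gcongr

theorem summable_pow_succ {r : ℝ} (h0 : 0 ≤ r) (h1 : r < 1) :
    Summable fun k : ℕ => r ^ (k + 1) :=
  (summable_nat_add_iff 1).2 (summable_geometric_of_lt_one h0 h1)

/-- The relation `w (d/dw) Li_{s+1} = Li_s` in the unit disc. -/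
theorem exists_hasDerivAt_polylog (s : ℕ) {w : ℂ} (hw : ‖w‖ < 1) :
    ∃ D : ℂ, HasDerivAt (polylog (s + 1)) D w ∧ w * D = polylog s w := by
  -- The geometric series in some r with ‖w‖ < r < 1 majorizes the series on the ball of radius r,
  -- which permits termwise differentiation.
  obtain ⟨r, hr, hr1⟩ := exists_between hw
  have hr0 : 0 ≤ r := (norm_nonneg w).trans hr.le
  have hmem : w ∈ Metric.ball (0 : ℂ) r := by simpa using hr
  have hd : ∀ k : ℕ, DifferentiableOn ℂ
      (fun z : ℂ => z ^ (k + 1) / ((k : ℂ) + 1) ^ (s + 1)) (Metric.ball 0 r) := by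
    intro k; fun_prop
  have hb : ∀ (k : ℕ) (z : ℂ), z ∈ Metric.ball (0 : ℂ) r →
      ‖z ^ (k + 1) / ((k : ℂ) + 1) ^ (s + 1)‖ ≤ r ^ (k + 1) := by
    intro k z hz
    exact norm_polylog_term_le _ (by simpa using (Metric.mem_ball.1 hz).le) k
  have hdiff := Complex.differentiableOn_tsum_of_summable_norm (summable_pow_succ hr0 hr1) hd
    Metric.isOpen_ball hb
  have hsum := Complex.hasSum_deriv_of_summable_norm (summable_pow_succ hr0 hr1) hd
    Metric.isOpen_ball hb hmem
  refine ⟨_, (hdiff.differentiableAt (Metric.isOpen_ball.mem_nhds hmem)).hasDerivAt, ?_⟩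
  have hmul := hsum.mul_left w
  rw [← hmul.tsum_eq]
  refine tsum_congr fun k => ?_
  have hk : ((k : ℂ) + 1) ≠ 0 := Nat.cast_add_one_ne_zero k
  simp only [deriv_div_const, deriv_pow_field]
  push_cast
  rw [pow_succ w, pow_succ ((k : ℂ) + 1)]
  field_simp

theorem polylog_zero {w : ℂ} (hw : ‖w‖ < 1) : polylog 0 w = w / (1 - w) := by
  simp only [polylog, pow_zero, div_one, pow_succ']
  rw [tsum_mul_left, tsum_geometric_of_norm_lt_one hw, div_eq_mul_inv]

theorem norm_exp_neg_two_mul_lt_one {z : ℂ} (hz : 0 < z.re) : ‖Complex.exp (-2 * z)‖ < 1 := by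
  rw [Complex.norm_exp, Real.exp_lt_one_iff]
  simp
  exact hz

/-- The chain rule produces the derivative D of the series multiplied by −2w with w = e^{-2z}; this
is why the relation is kept in the form w D = Li_s, with no division by w. -/
theorem hasDerivAt_polylog_exp (s : ℕ) {z : ℂ} (hz : 0 < z.re) :
    HasDerivAt (fun z => polylog (s + 1) (Complex.exp (-2 * z)))
      (-2 * polylog s (Complex.exp (-2 * z))) z := by
  obtain ⟨D, hD, hw⟩ := exists_hasDerivAt_polylog s (norm_exp_neg_two_mul_lt_one hz)
  have he : HasDerivAt (fun z : ℂ => Complex.exp (-2 * z)) (Complex.exp (-2 * z) * (-2 * 1)) z :=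
    ((hasDerivAt_id z).const_mul (-2)).cexp
  have := hD.comp z he
  rw [← hw]
  exact this.congr_deriv (by ring)

/-- The first derivative of `fTilde`. -/
def fTilde₁ (z : ℂ) : ℂ := z ^ 2 / 2 + polylog 2 (Complex.exp (-2 * z)) / 2

/-- The second derivative of `fTilde`. -/
def fTilde₂ (z : ℂ) : ℂ := z - polylog 1 (Complex.exp (-2 * z))

theorem hasDerivAt_fTilde {z : ℂ} (hz : 0 < z.re) : HasDerivAt fTilde (fTilde₁ z) z := by
  have h := (((hasDerivAt_id z).pow 3).div_const 6).sub
    ((hasDerivAt_polylog_exp 2 hz).div_const 4)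
  refine h.congr_deriv ?_
  simp [fTilde₁]
  ring

theorem hasDerivAt_fTilde₁ {z : ℂ} (hz : 0 < z.re) : HasDerivAt fTilde₁ (fTilde₂ z) z := by
  have h := (((hasDerivAt_id z).pow 2).div_const 2).add
    ((hasDerivAt_polylog_exp 1 hz).div_const 2)
  refine h.congr_deriv ?_
  simp [fTilde₂]
  ring

/-- A zero of sinh would give e^{-2z} = 1, against ‖e^{-2z}‖ < 1. Hence every point of the chamber
tube is regular. -/
theorem sinh_ne_zero_of_re_pos {z : ℂ} (hz : 0 < z.re) : Complex.sinh z ≠ 0 := by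
  intro h
  have h2 : Complex.exp (-2 * z) = 1 := by
    have h3 : Complex.exp z = Complex.exp (-z) := by
      rw [Complex.sinh] at h
      linear_combination 2 * h
    rw [show -2 * z = -z + -z by ring, Complex.exp_add]
    nth_rewrite 1 [← h3]
    rw [← Complex.exp_add]
    simp
  have := norm_exp_neg_two_mul_lt_one hz
  rw [h2] at this
  simp at this

/-- With w = e^{-2z}, the derivative is 1 + 2 Li_0(w) = (1 + w)/(1 − w), which becomes coth z after
multiplying numerator and denominator by e^z. -/
theorem hasDerivAt_fTilde₂ {z : ℂ} (hz : 0 < z.re) : HasDerivAt fTilde₂ (coth z) z := by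
  have h := (hasDerivAt_id z).sub (hasDerivAt_polylog_exp 0 hz)
  refine h.congr_deriv ?_
  have hn := norm_exp_neg_two_mul_lt_one hz
  have h1 : 1 - Complex.exp (-2 * z) ≠ 0 := by
    intro h
    rw [← sub_eq_zero.1 h] at hn
    simp at hn
  have hs := sinh_ne_zero_of_re_pos hz
  rw [polylog_zero hn, coth, eq_div_iff hs]
  have h3 : 1 - -2 * (Complex.exp (-2 * z) / (1 - Complex.exp (-2 * z)))
      = (1 + Complex.exp (-2 * z)) / (1 - Complex.exp (-2 * z)) := by
    rw [eq_div_iff h1]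
    linear_combination 2 * div_mul_cancel₀ (Complex.exp (-2 * z)) h1
  rw [h3, div_mul_eq_mul_div, div_eq_iff h1, Complex.sinh, Complex.cosh,
    show Complex.exp (-2 * z) = Complex.exp (-z) * Complex.exp (-z) by
      rw [← Complex.exp_add]; ring_nf]
  have h2 : Complex.exp z * Complex.exp (-z) = 1 := by rw [← Complex.exp_add]; simp
  linear_combination Complex.exp (-z) * h2

/-! ### Third derivatives of the prepotential. -/

/-- The linear function `β` on `V ⊕ U`, trivial on `U`, as a continuous linear map. -/
def pairCLM {N : ℕ} (β : Fin N → ℝ) : (Fin (N + 1) → ℂ) →L[ℂ] ℂ :=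
  ∑ i : Fin N, (β i : ℂ) • ContinuousLinearMap.proj i.castSucc

@[simp] theorem pairCLM_apply {N : ℕ} (β : Fin N → ℝ) (z : Fin (N + 1) → ℂ) :
    pairCLM β z = pair β (xPart z) := by
  simp [pairCLM, pair, cvec, xPart, dotProduct]

/-- The formulas for the first and second derivatives hold only on the chamber tube; openness is
what allows them to be differentiated again. -/
theorem partialDeriv_congr {n : ℕ} {F G : (Fin n → ℂ) → ℂ} {U : Set (Fin n → ℂ)}
    (hU : IsOpen U) (h : ∀ z ∈ U, F z = G z) (i : Fin n) {z : Fin n → ℂ} (hz : z ∈ U) :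
    partialDeriv i F z = partialDeriv i G z := by
  have : F =ᶠ[nhds z] G := Filter.eventually_of_mem (hU.mem_nhds hz) h
  rw [partialDeriv, this.fderiv_eq, partialDeriv]

/-- Partial derivatives of `A + ∑ β ∈ P, w β * g (β(x))`. -/
theorem partialDeriv_add_sum {N : ℕ} {A : (Fin (N + 1) → ℂ) → ℂ} {P : Finset (Fin N → ℝ)}
    {w : (Fin N → ℝ) → ℂ} {g g' : ℂ → ℂ} {z : Fin (N + 1) → ℂ} (hA : DifferentiableAt ℂ A z)
    (hg : ∀ β ∈ P, HasDerivAt g (g' (pair β (xPart z))) (pair β (xPart z))) (i : Fin (N + 1)) :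
    partialDeriv i (fun z => A z + ∑ β ∈ P, w β * g (pair β (xPart z))) z =
      partialDeriv i A z + ∑ β ∈ P, w β * pair β (xPart (Pi.single i 1)) *
        g' (pair β (xPart z)) := by
  have h1 : ∀ β ∈ P, HasFDerivAt (fun z => w β * g (pair β (xPart z)))
      (w β • (g' (pair β (xPart z)) • pairCLM β)) z := by
    intro β hβ
    have h2 : HasFDerivAt (fun z => pair β (xPart z)) (pairCLM β) z := by
      rw [show (fun z => pair β (xPart z)) = pairCLM β from funext fun z => (pairCLM_apply β z).symm]
      exact (pairCLM β).hasFDerivAt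
    exact ((hg β hβ).comp_hasFDerivAt z h2).const_mul (w β)
  have h3 := hA.hasFDerivAt.add (HasFDerivAt.fun_sum h1)
  have h4 : fderiv ℂ (fun z => A z + ∑ β ∈ P, w β * g (pair β (xPart z))) z = _ := h3.fderiv
  rw [partialDeriv, h4, partialDeriv]
  simp [mul_comm, mul_left_comm]

/-- The cubic part of the prepotential. -/
def cubicPart {N : ℕ} (γ : ℂ) (z : Fin (N + 1) → ℂ) : ℂ :=
  γ / 6 * z (Fin.last N) ^ 3 + γ / 2 * z (Fin.last N) * (xPart z ⬝ᵥ xPart z)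

/-- The first partial derivatives of the cubic part. -/
def cubicPart₁ {N : ℕ} (γ : ℂ) (k : Fin (N + 1)) (z : Fin (N + 1) → ℂ) : ℂ :=
  Fin.lastCases (motive := fun _ => ℂ) (γ / 2 * (z (Fin.last N) ^ 2 + xPart z ⬝ᵥ xPart z))
    (fun i => γ * z (Fin.last N) * z i.castSucc) k

/-- The second partial derivatives of the cubic part. -/
def cubicPart₂ {N : ℕ} (γ : ℂ) (j k : Fin (N + 1)) (z : Fin (N + 1) → ℂ) : ℂ :=
  Fin.lastCases (motive := fun _ => ℂ) (γ * z j)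
    (fun i => γ * (if j = Fin.last N then z i.castSucc else
      if j = i.castSucc then z (Fin.last N) else 0)) k

theorem cubicPart₁_last {N : ℕ} (γ : ℂ) : cubicPart₁ γ (Fin.last N) =
    fun z => γ / 2 * (z (Fin.last N) ^ 2 + xPart z ⬝ᵥ xPart z) := by
  funext z; simp [cubicPart₁]

theorem cubicPart₁_castSucc {N : ℕ} (γ : ℂ) (i : Fin N) : cubicPart₁ γ i.castSucc =
    fun z => γ * z (Fin.last N) * z i.castSucc := by
  funext z; simp [cubicPart₁]

theorem cubicPart₂_last {N : ℕ} (γ : ℂ) (j : Fin (N + 1)) : cubicPart₂ γ j (Fin.last N) =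
    fun z => γ * z j := by
  funext z; simp [cubicPart₂]

theorem cubicPart₂_castSucc {N : ℕ} (γ : ℂ) (j : Fin (N + 1)) (i : Fin N) :
    cubicPart₂ γ j i.castSucc = fun z => γ * (if j = Fin.last N then z i.castSucc else
      if j = i.castSucc then z (Fin.last N) else 0) := by
  funext z; simp [cubicPart₂]

theorem hasFDerivAt_coord {n : ℕ} (k : Fin n) (z : Fin n → ℂ) :
    HasFDerivAt (fun z : Fin n → ℂ => z k)
      (ContinuousLinearMap.proj (R := ℂ) (φ := fun _ : Fin n => ℂ) k) z :=
  (ContinuousLinearMap.proj (R := ℂ) (φ := fun _ : Fin n => ℂ) k).hasFDerivAt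

theorem hasFDerivAt_xPart_dot {N : ℕ} (z : Fin (N + 1) → ℂ) :
    HasFDerivAt (fun z : Fin (N + 1) → ℂ => xPart z ⬝ᵥ xPart z)
      (∑ i : Fin N, (z i.castSucc • ContinuousLinearMap.proj (R := ℂ)
        (φ := fun _ : Fin (N + 1) => ℂ) i.castSucc + z i.castSucc • ContinuousLinearMap.proj
        (R := ℂ) (φ := fun _ : Fin (N + 1) => ℂ) i.castSucc)) z :=
  HasFDerivAt.fun_sum fun _ _ => (hasFDerivAt_coord _ z).mul (hasFDerivAt_coord _ z)

theorem differentiable_xPart_dot {N : ℕ} :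
    Differentiable ℂ (fun z : Fin (N + 1) → ℂ => xPart z ⬝ᵥ xPart z) :=
  fun z => (hasFDerivAt_xPart_dot z).differentiableAt

theorem differentiable_cubicPart {N : ℕ} (γ : ℂ) :
    Differentiable ℂ (cubicPart γ : (Fin (N + 1) → ℂ) → ℂ) := by
  have := differentiable_xPart_dot (N := N)
  unfold cubicPart
  fun_prop

theorem differentiable_cubicPart₁ {N : ℕ} (γ : ℂ) (k : Fin (N + 1)) :
    Differentiable ℂ (cubicPart₁ γ k) := by
  have := differentiable_xPart_dot (N := N)
  induction k using Fin.lastCases with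
  | last => rw [cubicPart₁_last]; fun_prop
  | cast i => rw [cubicPart₁_castSucc]; fun_prop

theorem differentiable_cubicPart₂ {N : ℕ} (γ : ℂ) (j k : Fin (N + 1)) :
    Differentiable ℂ (cubicPart₂ γ j k) := by
  induction k using Fin.lastCases with
  | last => rw [cubicPart₂_last]; fun_prop
  | cast i =>
    rw [cubicPart₂_castSucc]
    split_ifs <;> fun_prop

theorem partialDeriv_cubicPart {N : ℕ} (γ : ℂ) (k : Fin (N + 1)) (z : Fin (N + 1) → ℂ) :
    partialDeriv k (cubicPart γ) z = cubicPart₁ γ k z := by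
  have h := (((hasFDerivAt_coord (Fin.last N) z).pow 3).const_mul (γ / 6)).add
    (((hasFDerivAt_coord (Fin.last N) z).const_mul (γ / 2)).mul (hasFDerivAt_xPart_dot z))
  have h' : fderiv ℂ (cubicPart γ) z = _ := h.fderiv
  rw [partialDeriv, h']
  induction k using Fin.lastCases with
  | last =>
    simp [cubicPart₁]
    ring
  | cast i =>
    simp [cubicPart₁, Pi.single_apply, Finset.sum_add_distrib, (Fin.castSucc_lt_last i).ne']
    ring

theorem partialDeriv_cubicPart₁ {N : ℕ} (γ : ℂ) (j k : Fin (N + 1)) (z : Fin (N + 1) → ℂ) :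
    partialDeriv j (cubicPart₁ γ k) z = cubicPart₂ γ j k z := by
  induction k using Fin.lastCases with
  | last =>
    have h := (((hasFDerivAt_coord (Fin.last N) z).pow 2).add
      (hasFDerivAt_xPart_dot z)).const_mul (γ / 2)
    have h' : fderiv ℂ (cubicPart₁ γ (Fin.last N)) z = _ :=
      (h.congr_of_eventuallyEq (by rw [cubicPart₁_last]; rfl)).fderiv
    rw [partialDeriv, h']
    induction j using Fin.lastCases with
    | last => simp [cubicPart₂]; ring
    | cast i =>
      simp [cubicPart₂, Pi.single_apply, Finset.sum_add_distrib, (Fin.castSucc_lt_last i).ne']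
      ring
  | cast i =>
    have h := ((hasFDerivAt_coord (Fin.last N) z).const_mul γ).mul
      (hasFDerivAt_coord i.castSucc z)
    have h' : fderiv ℂ (cubicPart₁ γ i.castSucc) z = _ :=
      (h.congr_of_eventuallyEq (by rw [cubicPart₁_castSucc]; rfl)).fderiv
    rw [partialDeriv, h']
    induction j using Fin.lastCases with
    | last => simp [cubicPart₂]; ring
    | cast i =>
      simp [cubicPart₂, Pi.single_apply, (Fin.castSucc_lt_last i).ne', eq_comm]

/-- The constant third derivatives of the cubic part. -/
def cubicTensor {N : ℕ} (γ : ℂ) (i j k : Fin (N + 1)) : ℂ :=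
  Fin.lastCases (motive := fun _ => ℂ) (if i = j then γ else 0)
    (fun l => if j = Fin.last N then (if i = l.castSucc then γ else 0) else
      if j = l.castSucc then (if i = Fin.last N then γ else 0) else 0) k

theorem partialDeriv_cubicPart₂ {N : ℕ} (γ : ℂ) (i j k : Fin (N + 1)) (z : Fin (N + 1) → ℂ) :
    partialDeriv i (cubicPart₂ γ j k) z = cubicTensor γ i j k := by
  have aux : ∀ l : Fin (N + 1), partialDeriv i (fun z => γ * z l) z = if i = l then γ else 0 := by
    intro l
    rw [partialDeriv, ((hasFDerivAt_coord l z).const_mul γ).fderiv]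
    simp [Pi.single_apply, eq_comm]
  induction k using Fin.lastCases with
  | last =>
    rw [cubicPart₂_last, aux, cubicTensor, Fin.lastCases_last]
  | cast l =>
    rw [cubicPart₂_castSucc, cubicTensor, Fin.lastCases_castSucc]
    by_cases h1 : j = Fin.last N
    · simp only [h1, if_true, aux]
    · by_cases h2 : j = l.castSucc
      · simp only [h2, if_true, if_false, (Fin.castSucc_lt_last l).ne, aux]
      · simp [h1, h2, partialDeriv]

theorem isOpen_chamberTube {N : ℕ} (R : Finset (Fin N → ℝ)) (α : Fin N → (Fin N → ℝ)) :
    IsOpen (chamberTube R α) := by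
  have : chamberTube R α = ⋂ β ∈ posRoots R α, {z | 0 < (pairCLM β z).re} := by
    ext z; simp [chamberTube]
  rw [this]
  refine isOpen_biInter_finset fun β _ => isOpen_lt continuous_const ?_
  exact Complex.continuous_re.comp (pairCLM β).continuous

/-- Each differentiation multiplies the summand of β by one coordinate of β and moves one step along
`fTilde`, `fTilde₁`, `fTilde₂`, `coth`, while the cubic part ends in a constant tensor. -/
theorem thirdDerivMatrix_prepotential {N : ℕ} (R : Finset (Fin N → ℝ))
    (α : Fin N → (Fin N → ℝ)) (p q γ : ℂ) {z : Fin (N + 1) → ℂ} (hz : z ∈ chamberTube R α)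
    (i j k : Fin (N + 1)) :
    thirdDerivMatrix (prepotential R α p q γ) i z j k = cubicTensor γ i j k +
      ∑ β ∈ posRoots R α, weight R p q β * pair β (xPart (Pi.single k 1)) *
        pair β (xPart (Pi.single j 1)) * pair β (xPart (Pi.single i 1)) *
          coth (pair β (xPart z)) := by
  have hU := isOpen_chamberTube R α
  have h1 : ∀ z ∈ chamberTube R α, partialDeriv k (prepotential R α p q γ) z =
      cubicPart₁ γ k z + ∑ β ∈ posRoots R α,
        weight R p q β * pair β (xPart (Pi.single k 1)) * fTilde₁ (pair β (xPart z)) := by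
    intro z hz
    rw [← partialDeriv_cubicPart]
    exact partialDeriv_add_sum (differentiable_cubicPart γ z)
      (fun β hβ => hasDerivAt_fTilde (hz β hβ)) k
  have h2 : ∀ z ∈ chamberTube R α,
      partialDeriv j (partialDeriv k (prepotential R α p q γ)) z =
      cubicPart₂ γ j k z + ∑ β ∈ posRoots R α, weight R p q β * pair β (xPart (Pi.single k 1)) *
        pair β (xPart (Pi.single j 1)) * fTilde₂ (pair β (xPart z)) := by
    intro z hz
    rw [partialDeriv_congr hU h1 j hz, ← partialDeriv_cubicPart₁]
    exact partialDeriv_add_sum (differentiable_cubicPart₁ γ k z)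
      (fun β hβ => hasDerivAt_fTilde₁ (hz β hβ)) j
  rw [thirdDerivMatrix, Matrix.of_apply, partialDeriv_congr hU h2 i hz,
    ← partialDeriv_cubicPart₂ γ i j k z]
  exact partialDeriv_add_sum (differentiable_cubicPart₂ γ j k z)
    (fun β hβ => hasDerivAt_fTilde₂ (hz β hβ)) i

/-! ### The curvature identity, associativity and WDVV. -/

/-- The points at which all the functions `coth β(x)` are defined. -/
def IsRegular {N : ℕ} (R : Finset (Fin N → ℝ)) (x : Fin N → ℂ) : Prop :=
  ∀ β ∈ R, Complex.sinh (pair β x) ≠ 0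

/-- The matrix `∑_{β ∈ P} d_β β(u) coth(β(x)) β ⊗ β`. -/
def structMatrix {N : ℕ} (R P : Finset (Fin N → ℝ)) (p q : ℂ) (x u : Fin N → ℂ) :
    Matrix (Fin N) (Fin N) ℂ :=
  ∑ β ∈ P, (weight R p q β * pair β u * coth (pair β x)) • Matrix.vecMulVec (cvec β) (cvec β)

/-- The commutators of the multiplication matrices are `K` times those of the identity
curvature tensor. -/
def HasCurvature {N : ℕ} (R P : Finset (Fin N → ℝ)) (p q : ℂ) (x : Fin N → ℂ) (K : ℂ) : Prop :=
  ∀ i j : Fin N, i ≠ j →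
    structMatrix R P p q x (Pi.single i 1) * structMatrix R P p q x (Pi.single j 1) -
      structMatrix R P p q x (Pi.single j 1) * structMatrix R P p q x (Pi.single i 1) =
    K • (Matrix.single i j 1 - Matrix.single j i 1)

theorem pair_single {N : ℕ} (β : Fin N → ℝ) (i : Fin N) : pair β (Pi.single i 1) = β i := by
  simp [pair, cvec]

theorem structMatrix_single_apply {N : ℕ} (R P : Finset (Fin N → ℝ)) (p q : ℂ) (x : Fin N → ℂ)
    (i j k : Fin N) : structMatrix R P p q x (Pi.single i 1) j k =
      ∑ β ∈ P, weight R p q β * β i * β j * β k * coth (pair β x) := by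
  rw [structMatrix, Matrix.sum_apply]
  refine Finset.sum_congr rfl fun β _ => ?_
  simp only [Matrix.smul_apply, Matrix.vecMulVec_apply, pair_single, cvec, smul_eq_mul]
  ring

theorem structMatrix_eq_sum {N : ℕ} (R P : Finset (Fin N → ℝ)) (p q : ℂ) (x u : Fin N → ℂ) :
    structMatrix R P p q x u = ∑ i, u i • structMatrix R P p q x (Pi.single i 1) := by
  simp only [structMatrix, Finset.smul_sum]
  rw [Finset.sum_comm]
  refine Finset.sum_congr rfl fun β _ => ?_
  simp only [smul_smul]
  rw [← Finset.sum_smul]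
  congr 1
  simp only [pair_single]
  simp only [pair, cvec, dotProduct, Finset.mul_sum, Finset.sum_mul]
  exact Finset.sum_congr rfl fun i _ => by ring

theorem sum_smul_single {N : ℕ} (u w : Fin N → ℂ) :
    ∑ i, ∑ j, (u i * w j) • Matrix.single i j (1 : ℂ) = Matrix.vecMulVec u w := by
  ext a b
  simp [Matrix.sum_apply, Matrix.single_apply, Matrix.vecMulVec_apply, ite_and, Finset.sum_ite_irrel]

/-- Both sides are bilinear in u and w and agree on pairs of basis vectors; equal basis vectors give
zero on both sides. -/
theorem HasCurvature.commutator {N : ℕ} {R P : Finset (Fin N → ℝ)} {p q : ℂ} {x : Fin N → ℂ}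
    {K : ℂ} (h : HasCurvature R P p q x K) (u w : Fin N → ℂ) :
    structMatrix R P p q x u * structMatrix R P p q x w -
      structMatrix R P p q x w * structMatrix R P p q x u =
    K • (Matrix.vecMulVec u w - Matrix.vecMulVec w u) := by
  set M := fun i => structMatrix R P p q x (Pi.single i 1) with hM
  have h' : ∀ i j, M i * M j - M j * M i = K • (Matrix.single i j 1 - Matrix.single j i 1) := by
    intro i j
    by_cases hij : i = j
    · subst hij; simp
    · exact h i j hij
  have e1 : ∀ a b : Fin N → ℂ, structMatrix R P p q x a * structMatrix R P p q x b =
      ∑ i, ∑ j, (a i * b j) • (M i * M j) := by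
    intro a b
    rw [structMatrix_eq_sum R P p q x a, structMatrix_eq_sum R P p q x b, Finset.sum_mul_sum]
    simp only [smul_mul_smul_comm, hM]
  have e2 : structMatrix R P p q x w * structMatrix R P p q x u =
      ∑ i, ∑ j, (u i * w j) • (M j * M i) := by
    rw [e1, Finset.sum_comm]
    simp only [mul_comm]
  have e3 : Matrix.vecMulVec w u = ∑ i, ∑ j, (u i * w j) • Matrix.single j i (1 : ℂ) := by
    rw [← sum_smul_single, Finset.sum_comm]
    simp only [mul_comm]
  rw [e1, e2, ← sum_smul_single u w, e3, ← Finset.sum_sub_distrib, ← Finset.sum_sub_distrib,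
    Finset.smul_sum]
  refine Finset.sum_congr rfl fun i _ => ?_
  rw [← Finset.sum_sub_distrib, ← Finset.sum_sub_distrib, Finset.smul_sum]
  refine Finset.sum_congr rfl fun j _ => ?_
  rw [← smul_sub, h', ← smul_sub, smul_comm]

theorem prodV_eq_mulVec {N : ℕ} (R : Finset (Fin N → ℝ)) (α : Fin N → (Fin N → ℝ))
    (p q γ : ℂ) (x u v : Fin N → ℂ) :
    prodV R α p q γ x u v = γ⁻¹ • (structMatrix R (posRoots R α) p q x u *ᵥ v) := by
  rw [prodV, structMatrix, Matrix.sum_mulVec]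
  congr 1
  refine Finset.sum_congr rfl fun β _ => ?_
  rw [Matrix.smul_mulVec, Matrix.vecMulVec_mulVec]
  ext k
  simp only [pair, Pi.smul_apply, smul_eq_mul, MulOpposite.smul_eq_mul_unop, MulOpposite.unop_op]
  ring

theorem prodV_comm {N : ℕ} (R : Finset (Fin N → ℝ)) (α : Fin N → (Fin N → ℝ))
    (p q γ : ℂ) (x u v : Fin N → ℂ) : prodV R α p q γ x u v = prodV R α p q γ x v u := by
  rw [prodV, prodV]
  congr 1
  refine Finset.sum_congr rfl fun β _ => ?_
  rw [mul_right_comm (weight R p q β)]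

/-- Invariance of the bilinear form, from the total symmetry of ∑ d_β coth β(x) β⊗β⊗β. It settles
the E-component of associativity for every γ. -/
theorem dotProduct_prodV {N : ℕ} (R : Finset (Fin N → ℝ)) (α : Fin N → (Fin N → ℝ))
    (p q γ : ℂ) (x u v w : Fin N → ℂ) :
    prodV R α p q γ x u v ⬝ᵥ w = u ⬝ᵥ prodV R α p q γ x v w := by
  simp only [prodV, smul_dotProduct, dotProduct_smul, sum_dotProduct, dotProduct_sum]
  congr 1
  refine Finset.sum_congr rfl fun β _ => ?_
  simp only [pair, smul_eq_mul, dotProduct_comm u]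
  ring

theorem prodV_add_right {N : ℕ} (R : Finset (Fin N → ℝ)) (α : Fin N → (Fin N → ℝ))
    (p q γ : ℂ) (x u v w : Fin N → ℂ) :
    prodV R α p q γ x u (v + w) = prodV R α p q γ x u v + prodV R α p q γ x u w := by
  simp only [prodV_eq_mulVec, Matrix.mulVec_add, smul_add]

theorem prodV_smul_right {N : ℕ} (R : Finset (Fin N → ℝ)) (α : Fin N → (Fin N → ℝ))
    (p q γ : ℂ) (x u v : Fin N → ℂ) (c : ℂ) :
    prodV R α p q γ x u (c • v) = c • prodV R α p q γ x u v := by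
  simp only [prodV_eq_mulVec, Matrix.mulVec_smul]
  rw [smul_comm]

theorem HasCurvature.prodV_sub {N : ℕ} {R : Finset (Fin N → ℝ)} {α : Fin N → (Fin N → ℝ)}
    {p q : ℂ} {x : Fin N → ℂ} {K : ℂ} (h : HasCurvature R (posRoots R α) p q x K) (γ : ℂ)
    (u v w : Fin N → ℂ) :
    prodV R α p q γ x u (prodV R α p q γ x w v) - prodV R α p q γ x w (prodV R α p q γ x u v) =
      (γ⁻¹ ^ 2 * K) • ((w ⬝ᵥ v) • u - (u ⬝ᵥ v) • w) := by
  have h1 := congrArg (· *ᵥ v) (h.commutator u w)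
  simp only [Matrix.sub_mulVec, ← Matrix.mulVec_mulVec, Matrix.smul_mulVec,
    Matrix.vecMulVec_mulVec, op_smul_eq_smul] at h1
  simp only [prodV_eq_mulVec, Matrix.mulVec_smul, ← smul_sub, smul_smul, h1]
  rw [pow_two]

/-- With K = −γ² the commutator term cancels exactly the terms ⟨v,w⟩u − ⟨u,v⟩w created by the
products that land in ℂE. -/
theorem HasCurvature.assoc {N : ℕ} {R : Finset (Fin N → ℝ)} {α : Fin N → (Fin N → ℝ)}
    {p q γ : ℂ} {x : Fin N → ℂ} (hγ : γ ≠ 0)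
    (h : HasCurvature R (posRoots R α) p q x (-γ ^ 2)) (X Y Z : (Fin N → ℂ) × ℂ) :
    mul R α p q γ x (mul R α p q γ x X Y) Z = mul R α p q γ x X (mul R α p q γ x Y Z) := by
  obtain ⟨u, a⟩ := X
  obtain ⟨v, b⟩ := Y
  obtain ⟨w, c⟩ := Z
  have h1 := h.prodV_sub γ u v w
  rw [prodV_comm R α p q γ x w v, prodV_comm R α p q γ x w (prodV R α p q γ x u v),
    show γ⁻¹ ^ 2 * -γ ^ 2 = -1 by field_simp, dotProduct_comm w v] at h1
  have h2 := dotProduct_prodV R α p q γ x u v w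
  have hl : ∀ a b c : Fin N → ℂ, prodV R α p q γ x (a + b) c =
      prodV R α p q γ x a c + prodV R α p q γ x b c := fun a b c => by
    rw [prodV_comm, prodV_add_right, prodV_comm _ _ _ _ _ _ c a, prodV_comm _ _ _ _ _ _ c b]
  have hs : ∀ (t : ℂ) (a c : Fin N → ℂ), prodV R α p q γ x (t • a) c =
      t • prodV R α p q γ x a c := fun t a c => by
    rw [prodV_comm, prodV_smul_right, prodV_comm _ _ _ _ _ _ c a]
  simp only [mul, Prod.mk.injEq]
  constructor
  · rw [sub_eq_iff_eq_add] at h1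
    simp only [hl, hs, prodV_add_right, prodV_smul_right, h1]
    module
  · simp only [add_dotProduct, dotProduct_add, smul_dotProduct, dotProduct_smul, h2, smul_eq_mul]
    ring

/-- On the triple e_1, e_1, e_2 the V-component of the associator is a multiple of e_2 with factor
γ⁻²K + 1 up to sign; this needs two distinct basis vectors. -/
theorem HasCurvature.eq_of_assoc {N : ℕ} (hN : 2 ≤ N) {R : Finset (Fin N → ℝ)}
    {α : Fin N → (Fin N → ℝ)} {p q γ K : ℂ} {x : Fin N → ℂ} (hγ : γ ≠ 0)
    (h : HasCurvature R (posRoots R α) p q x K)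
    (ha : ∀ X Y Z : (Fin N → ℂ) × ℂ,
      mul R α p q γ x (mul R α p q γ x X Y) Z = mul R α p q γ x X (mul R α p q γ x Y Z)) :
    γ ^ 2 = -K := by
  let i : Fin N := ⟨0, by omega⟩
  let j : Fin N := ⟨1, by omega⟩
  have hij : i ≠ j := by simp [i, j]
  have h1 := congrArg Prod.fst (ha (Pi.single i 1, 0) (Pi.single i 1, 0) (Pi.single j 1, 0))
  have h2 := h.prodV_sub γ (Pi.single i 1) (Pi.single i 1) (Pi.single j 1)
  rw [prodV_comm _ _ _ _ _ _ (Pi.single j 1) (Pi.single i 1),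
    prodV_comm _ _ _ _ _ _ (Pi.single j 1) (prodV _ _ _ _ _ _ _ _)] at h2
  have h3 := congrFun h1 j
  have h4 := congrFun h2 j
  simp [mul, hij.symm] at h3
  simp [hij] at h4
  field_simp at h4
  linear_combination h4 + γ ^ 2 * h3

theorem xPart_single_castSucc {N : ℕ} (i : Fin N) :
    xPart (Pi.single i.castSucc (1 : ℂ)) = Pi.single i 1 := by
  ext j; simp [xPart, Pi.single_apply]

theorem xPart_single_last {N : ℕ} : xPart (Pi.single (Fin.last N) (1 : ℂ)) = 0 := by
  ext j; simp [xPart, (Fin.castSucc_lt_last j).ne]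

/-- The block form of the matrices of third derivatives. -/
theorem thirdDerivMatrix_castSucc {N : ℕ} {R : Finset (Fin N → ℝ)}
    {α : Fin N → (Fin N → ℝ)} {p q γ : ℂ} {z : Fin (N + 1) → ℂ} (hz : z ∈ chamberTube R α)
    (i : Fin N) :
    (∀ j k : Fin N, thirdDerivMatrix (prepotential R α p q γ) i.castSucc z j.castSucc k.castSucc =
      structMatrix R (posRoots R α) p q (xPart z) (Pi.single i 1) j k) ∧
    (∀ j : Fin N, thirdDerivMatrix (prepotential R α p q γ) i.castSucc z j.castSucc (Fin.last N) =
      if i = j then γ else 0) ∧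
    (∀ j : Fin N, thirdDerivMatrix (prepotential R α p q γ) i.castSucc z (Fin.last N) j.castSucc =
      if i = j then γ else 0) ∧
    thirdDerivMatrix (prepotential R α p q γ) i.castSucc z (Fin.last N) (Fin.last N) = 0 := by
  have hl : ∀ i : Fin N, i.castSucc ≠ Fin.last N := fun i => (Fin.castSucc_lt_last i).ne
  have h0 : ∀ β : Fin N → ℝ, pair β 0 = 0 := fun β => by simp [pair]
  refine ⟨fun j k => ?_, fun j => ?_, fun j => ?_, ?_⟩ <;>
  rw [thirdDerivMatrix_prepotential R α p q γ hz] <;>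
  simp only [xPart_single_castSucc, xPart_single_last, h0, pair_single,
    structMatrix_single_apply, cubicTensor, Fin.lastCases_castSucc, Fin.lastCases_last, hl,
    Fin.castSucc_inj, mul_zero, zero_mul, Finset.sum_const_zero, add_zero, if_true, if_false,
    ite_self, zero_add]
  exact Finset.sum_congr rfl fun β _ => by ring

/-- All roots vanish in the direction of U, so only the cubic part survives. -/
theorem thirdDerivMatrix_last {N : ℕ} {R : Finset (Fin N → ℝ)}
    {α : Fin N → (Fin N → ℝ)} {p q γ : ℂ} {z : Fin (N + 1) → ℂ} (hz : z ∈ chamberTube R α) :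
    thirdDerivMatrix (prepotential R α p q γ) (Fin.last N) z = γ • 1 := by
  have hl : ∀ i : Fin N, i.castSucc ≠ Fin.last N := fun i => (Fin.castSucc_lt_last i).ne
  have h0 : ∀ β : Fin N → ℝ, pair β 0 = 0 := fun β => by simp [pair]
  ext j k
  rw [thirdDerivMatrix_prepotential R α p q γ hz]
  induction j using Fin.lastCases <;> induction k using Fin.lastCases <;>
  simp [xPart_single_last, h0, cubicTensor, hl, (hl _).symm, Matrix.one_apply]

/-- Since F_{N+1} is scalar, WDVV says that the F_i commute. In the upper left block the border
contributes γ²(E_ij − E_ji) on top of K(E_ij − E_ji); the other blocks of the commutator vanish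
whatever γ is. -/
theorem HasCurvature.wdvv_iff {N : ℕ} (hN : 2 ≤ N) {R : Finset (Fin N → ℝ)}
    {α : Fin N → (Fin N → ℝ)} {p q γ K : ℂ} (hγ : γ ≠ 0) {z : Fin (N + 1) → ℂ}
    (hz : z ∈ chamberTube R α) (h : HasCurvature R (posRoots R α) p q (xPart z) K) :
    (IsUnit (thirdDerivMatrix (prepotential R α p q γ) (Fin.last N) z) ∧
      ∀ i j : Fin N,
        thirdDerivMatrix (prepotential R α p q γ) i.castSucc z *
          (thirdDerivMatrix (prepotential R α p q γ) (Fin.last N) z)⁻¹ *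
            thirdDerivMatrix (prepotential R α p q γ) j.castSucc z =
        thirdDerivMatrix (prepotential R α p q γ) j.castSucc z *
          (thirdDerivMatrix (prepotential R α p q γ) (Fin.last N) z)⁻¹ *
            thirdDerivMatrix (prepotential R α p q γ) i.castSucc z) ↔ γ ^ 2 = -K := by
  have hu : IsUnit (γ • (1 : Matrix (Fin (N + 1)) (Fin (N + 1)) ℂ)) := by
    rw [Matrix.isUnit_iff_isUnit_det]
    simp [hγ]
  have hinv : (γ • (1 : Matrix (Fin (N + 1)) (Fin (N + 1)) ℂ))⁻¹ = γ⁻¹ • 1 := by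
    apply Matrix.inv_eq_left_inv
    simp [smul_smul, hγ]
  rw [thirdDerivMatrix_last hz, hinv]
  simp only [hu, true_and, mul_smul_comm, mul_one, smul_mul_assoc]
  set F := fun i : Fin N => thirdDerivMatrix (prepotential R α p q γ) i.castSucc z with hF
  have hc : ∀ i j a b : Fin N, (F i * F j - F j * F i) a.castSucc b.castSucc =
      (K + γ ^ 2) * ((if i = a then 1 else 0) * (if j = b then 1 else 0) -
        (if j = a then 1 else 0) * (if i = b then 1 else 0)) := by
    intro i j a b
    have h1 := congrFun (congrFun (h.commutator (Pi.single i 1) (Pi.single j 1)) a) b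
    rw [Matrix.sub_apply, Matrix.mul_apply, Matrix.mul_apply] at h1
    rw [Matrix.sub_apply, Matrix.mul_apply, Matrix.mul_apply, Fin.sum_univ_castSucc,
      Fin.sum_univ_castSucc]
    simp only [hF, (thirdDerivMatrix_castSucc hz _).1, (thirdDerivMatrix_castSucc hz _).2.1,
      (thirdDerivMatrix_castSucc hz _).2.2.1]
    rw [add_sub_add_comm, h1]
    simp only [Matrix.smul_apply, Matrix.sub_apply, Matrix.vecMulVec_apply, Pi.single_apply,
      smul_eq_mul, @eq_comm _ a, @eq_comm _ b]
    have hg : ∀ i a : Fin N, (if i = a then γ else 0) = γ * (if i = a then 1 else 0) := by simp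
    simp only [hg]
    ring
  -- Here the two products are γ times the third derivatives with indices (i, a, j) and (j, a, i),
  -- equal by total symmetry; the last row is similar.
  have hcl : ∀ i j a : Fin N, (F i * F j - F j * F i) a.castSucc (Fin.last N) = 0 := by
    intro i j a
    rw [Matrix.sub_apply, Matrix.mul_apply, Matrix.mul_apply, Fin.sum_univ_castSucc,
      Fin.sum_univ_castSucc]
    simp only [hF, (thirdDerivMatrix_castSucc hz _).1, (thirdDerivMatrix_castSucc hz _).2.1,
      (thirdDerivMatrix_castSucc hz _).2.2.2]
    simp only [structMatrix_single_apply, mul_ite, mul_zero, Finset.sum_ite_eq, Finset.mem_univ,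
      if_true, add_zero]
    rw [sub_eq_zero]
    congr 1
    exact Finset.sum_congr rfl fun β _ => by ring
  have hlc : ∀ i j a : Fin N, (F i * F j - F j * F i) (Fin.last N) a.castSucc = 0 := by
    intro i j a
    rw [Matrix.sub_apply, Matrix.mul_apply, Matrix.mul_apply, Fin.sum_univ_castSucc,
      Fin.sum_univ_castSucc]
    simp only [hF, (thirdDerivMatrix_castSucc hz _).1, (thirdDerivMatrix_castSucc hz _).2.2.1,
      (thirdDerivMatrix_castSucc hz _).2.2.2]
    simp only [structMatrix_single_apply, ite_mul, zero_mul, Finset.sum_ite_eq, Finset.mem_univ,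
      if_true, add_zero]
    rw [sub_eq_zero]
    congr 1
    exact Finset.sum_congr rfl fun β _ => by ring
  have hll : ∀ i j : Fin N, (F i * F j - F j * F i) (Fin.last N) (Fin.last N) = 0 := by
    intro i j
    rw [Matrix.sub_apply, Matrix.mul_apply, Matrix.mul_apply, Fin.sum_univ_castSucc,
      Fin.sum_univ_castSucc]
    simp only [hF, (thirdDerivMatrix_castSucc hz _).2.1, (thirdDerivMatrix_castSucc hz _).2.2.1,
      (thirdDerivMatrix_castSucc hz _).2.2.2]
    simp [eq_comm]
  constructor
  · intro hw
    let i : Fin N := ⟨0, by omega⟩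
    let j : Fin N := ⟨1, by omega⟩
    have hij : i ≠ j := by simp [i, j]
    have h1 : F i * F j = F j * F i := by
      have := congrArg (γ • ·) (hw i j)
      simpa [smul_smul, hγ] using this
    have h2 := hc i j i j
    rw [h1, sub_self] at h2
    simp [hij, hij.symm] at h2
    linear_combination -h2
  · intro hK i j
    congr 1
    rw [← sub_eq_zero]
    ext a b
    induction a using Fin.lastCases with
    | last =>
      induction b using Fin.lastCases with
      | last => exact hll i j
      | cast b => exact hlc i j b
    | cast a =>
      induction b using Fin.lastCases with
      | last => exact hcl i j a
      | cast b =>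
        refine (hc i j a b).trans ?_
        rw [hK]
        simp

/-! ### Positive roots, highest root and reduction to the curvature identity. -/

theorem pair_neg {N : ℕ} (β : Fin N → ℝ) (x : Fin N → ℂ) : pair (-β) x = -pair β x := by
  simp [pair, cvec, dotProduct]

theorem pair_ofReal {N : ℕ} (β x : Fin N → ℝ) :
    pair β (fun i => (x i : ℂ)) = ((β ⬝ᵥ x : ℝ) : ℂ) := by
  simp [pair, cvec, dotProduct]

/-- A one-sided inverse of a square matrix is two-sided, so duality alone makes the α_i a basis
whose coordinate functions are the l_i. -/
theorem dual_expansion {N : ℕ} {α l : Fin N → (Fin N → ℝ)}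
    (hdual : ∀ i j, l i ⬝ᵥ α j = if i = j then 1 else 0) (v : Fin N → ℝ) :
    v = ∑ i, (l i ⬝ᵥ v) • α i := by
  have h1 : Matrix.of l * (Matrix.of α)ᵀ = 1 := by
    ext i j
    simpa [Matrix.mul_apply, Matrix.one_apply] using! hdual i j
  have h2 := mul_eq_one_comm.1 h1
  have h3 : v = ((Matrix.of α)ᵀ * Matrix.of l) *ᵥ v := by rw [h2, Matrix.one_mulVec]
  rw [← Matrix.mulVec_mulVec, Matrix.mulVec_eq_sum] at h3
  simpa [Matrix.mulVec] using! h3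

theorem dual_sum {N : ℕ} {α l : Fin N → (Fin N → ℝ)}
    (hdual : ∀ i j, l i ⬝ᵥ α j = if i = j then 1 else 0) (m : Fin N → ℝ) (i : Fin N) :
    l i ⬝ᵥ ∑ j, m j • α j = m i := by
  simp [dotProduct_sum, dotProduct_smul, hdual]

/-- Recognition of the positive roots. -/
theorem posRoots_eq {N : ℕ} {R P : Finset (Fin N → ℝ)} {α l : Fin N → (Fin N → ℝ)}
    {x₀ : Fin N → ℝ} (hdual : ∀ i j, l i ⬝ᵥ α j = if i = j then 1 else 0)
    (hR : ∀ β, β ∈ R ↔ β ∈ P ∨ -β ∈ P) (hint : ∀ β ∈ P, ∀ i, ∃ m : ℕ, l i ⬝ᵥ β = m)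
    (hx₀ : ∀ β ∈ P, 0 < β ⬝ᵥ x₀) (hα : ∀ i, α i ∈ P) : posRoots R α = P := by
  ext β
  simp only [posRoots, Finset.mem_filter, hR]
  constructor
  · rintro ⟨h | h, m, hm⟩
    · exact h
    -- A combination of simple roots with coefficients in ℕ pairs non-negatively with x₀, whereas −β
    -- ∈ P makes the pairing negative.
    · exfalso
      have h1 := hx₀ _ h
      have h2 : 0 ≤ β ⬝ᵥ x₀ := by
        rw [hm, sum_dotProduct]
        refine Finset.sum_nonneg fun i _ => ?_
        rw [smul_dotProduct]
        exact mul_nonneg (Nat.cast_nonneg _) (hx₀ _ (hα i)).le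
      rw [neg_dotProduct] at h1
      linarith
  · intro h
    refine ⟨Or.inl h, ?_⟩
    choose m hm using hint β h
    refine ⟨m, ?_⟩
    simp only [← hm]
    exact dual_expansion hdual β

theorem isHighest_of_dual {N : ℕ} {R P : Finset (Fin N → ℝ)} {α l : Fin N → (Fin N → ℝ)}
    {n : Fin N → ℤ} (hdual : ∀ i j, l i ⬝ᵥ α j = if i = j then 1 else 0)
    (hR : ∀ β, β ∈ R ↔ β ∈ P ∨ -β ∈ P) (hint : ∀ β ∈ P, ∀ i, ∃ m : ℕ, l i ⬝ᵥ β = m)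
    (hα : ∀ i, α i ∈ P) (hθ : ∑ i, (n i : ℝ) • α i ∈ P)
    (hmax : ∀ β ∈ P, ∀ i, l i ⬝ᵥ β ≤ n i) : IsHighest R α n := by
  refine ⟨(hR _).2 (Or.inl hθ), fun m hm i => ?_⟩
  have h1 := dual_sum hdual (fun i => (m i : ℝ)) i
  rw [← @Int.cast_le ℝ, ← h1]
  rcases (hR _).1 hm with h | h
  · exact hmax _ h i
  -- For the negative of a member of P the coefficient is at most 0, while n_i ≥ 1 because α_i
  -- itself lies in P.
  · obtain ⟨k, hk⟩ := hint _ h i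
    have h2 := hmax _ (hα i) i
    rw [hdual, if_pos rfl] at h2
    rw [dotProduct_neg] at hk
    have : (0 : ℝ) ≤ k := Nat.cast_nonneg k
    linarith

theorem IsHighest.unique {N : ℕ} {R : Finset (Fin N → ℝ)} {α : Fin N → (Fin N → ℝ)}
    {n n' : Fin N → ℤ} (h : IsHighest R α n) (h' : IsHighest R α n') : n = n' :=
  funext fun i => le_antisymm (h'.2 n h.1 i) (h.2 n' h'.1 i)

theorem cvec_dotProduct {N : ℕ} (β δ : Fin N → ℝ) :
    cvec β ⬝ᵥ cvec δ = ((β ⬝ᵥ δ : ℝ) : ℂ) := by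
  simp [cvec, dotProduct]

/-- Reduction of the main statement to the computation of the commutators. -/
theorem gammaFormula_of_hasCurvature {N : ℕ} (hN : 2 ≤ N) {R P : Finset (Fin N → ℝ)}
    {α : Fin N → (Fin N → ℝ)} (l : Fin N → (Fin N → ℝ)) (x₀ θ : Fin N → ℝ) (n : Fin N → ℤ)
    (K : ℂ) {p q a₀ : ℂ} {a : Fin N → ℂ}
    (hdual : ∀ i j, l i ⬝ᵥ α j = if i = j then 1 else 0)
    (hR : ∀ β, β ∈ R ↔ β ∈ P ∨ -β ∈ P) (hint : ∀ β ∈ P, ∀ i, ∃ m : ℕ, l i ⬝ᵥ β = m)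
    (hx₀ : ∀ β ∈ P, 0 < β ⬝ᵥ x₀) (hα : ∀ i, α i ∈ P) (hθ : θ ∈ P) (hn : ∀ i, l i ⬝ᵥ θ = n i)
    (hmax : ∀ β ∈ P, ∀ i, l i ⬝ᵥ β ≤ n i)
    (hK : ∀ x, IsRegular P x → HasCurvature R P p q x K)
    (hγ : a₀ * ((θ ⬝ᵥ θ : ℝ) : ℂ) + ∑ i, a i * (n i : ℂ) ^ 2 * ((α i ⬝ᵥ α i : ℝ) : ℂ) = 8 * K) :
    GammaFormula R α p q a₀ a := by
  have hθ' : ∑ i, (n i : ℝ) • α i = θ := by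
    simp only [← hn]
    exact (dual_expansion hdual θ).symm
  replace hγ : gammaSq α n a₀ a = -K := by
    rw [gammaSq, hθ']
    simp only [cvec_dotProduct, hγ]
    ring
  rw [← hθ'] at hθ
  replace hn := isHighest_of_dual hdual hR hint hα hθ hmax
  have hP := posRoots_eq hdual hR hint hx₀ hα
  refine ⟨⟨n, hn⟩, fun n' hn' γ hγ0 => ?_⟩
  rw [hn'.unique hn, hγ]
  have hreg : ∀ x, IsRegular P x → IsRegular R x := by
    intro x hx β hβ
    rcases (hR β).1 hβ with h | h
    · exact hx β h
    · have := hx _ h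
      rw [pair_neg, Complex.sinh_neg] at this
      exact neg_ne_zero.1 this
  have hreg' : ∀ x, IsRegular R x → IsRegular P x := fun x hx β hβ =>
    hx β ((hR β).2 (Or.inl hβ))
  have hch : ∀ z ∈ chamberTube R α, IsRegular P (xPart z) := by
    intro z hz β hβ
    exact sinh_ne_zero_of_re_pos (hz β (by rwa [hP]))
  -- The tube is non-empty: x₀ with y = 0 lies in it. This one point serves for the necessity of γ²
  -- = −K in both equivalences.
  have hz₀ : (Fin.snoc (fun i => (x₀ i : ℂ)) 0 : Fin (N + 1) → ℂ) ∈ chamberTube R α := by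
    intro β hβ
    rw [hP] at hβ
    have : xPart (Fin.snoc (fun i => (x₀ i : ℂ)) 0 : Fin (N + 1) → ℂ) =
        fun i => (x₀ i : ℂ) := by
      ext i; simp [xPart]
    rw [this, pair_ofReal, Complex.ofReal_re]
    exact hx₀ β hβ
  rw [← hP] at hK
  constructor
  · constructor
    · intro h
      exact (hK _ (hP ▸ hch _ hz₀)).eq_of_assoc hN hγ0 (h _ (hreg _ (hch _ hz₀)))
    · intro h x hx X Y Z
      have h1 := hK x (hP ▸ hreg' x hx)
      rw [show K = -γ ^ 2 by rw [h, neg_neg]] at h1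
      exact h1.assoc hγ0 X Y Z
  · constructor
    · intro h
      exact ((hK _ (hP ▸ hch _ hz₀)).wdvv_iff hN hγ0 hz₀).1 (h _ hz₀)
    · intro h z hz
      exact ((hK _ (hP ▸ hch _ hz)).wdvv_iff hN hγ0 hz).2 h

/-! ### The coth addition theorem and the commutator algebra of types B and C. -/

/-- The addition theorem of the hyperbolic cotangent. -/
theorem coth_add_mul {a b c : ℂ} (ha : Complex.sinh a ≠ 0) (hb : Complex.sinh b ≠ 0)
    (hc : Complex.sinh c ≠ 0) (h : a + b = c) :
    coth c * (coth a + coth b) = 1 + coth a * coth b := by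
  subst h
  rw [coth, coth, coth]
  field_simp
  rw [Complex.sinh_add, Complex.cosh_add]
  ring

/-- The structure matrices of the types `B` and `C`. -/
def typeBMatrix {N : ℕ} (c : Fin N → ℂ) (G : Fin N → Fin N → ℂ) (i : Fin N) :
    Matrix (Fin N) (Fin N) ℂ :=
  Matrix.of fun a b =>
    (if a = b then G i a + (if a = i then c i + ∑ m, G i m else 0) else 0) +
      (if a = i then G b i else 0) + (if b = i then G a i else 0)

theorem typeBMatrix_mul_apply {N : ℕ} (c : Fin N → ℂ) (G : Fin N → Fin N → ℂ)
    (i j a b : Fin N) : (typeBMatrix c G i * typeBMatrix c G j) a b =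
      (G i a + (if a = i then c i + ∑ m, G i m else 0)) * typeBMatrix c G j a b +
      (if a = i then G b i * (G j b + (if b = j then c j + ∑ m, G j m else 0)) + G j i * G b j +
        (if b = j then ∑ m, G m i * G m j else 0) else 0) + G a i * typeBMatrix c G j i b := by
  have h : ∑ m, G m i * typeBMatrix c G j m b =
      G b i * (G j b + (if b = j then c j + ∑ m, G j m else 0)) + G j i * G b j +
        (if b = j then ∑ m, G m i * G m j else 0) := by
    simp only [typeBMatrix, Matrix.of_apply, mul_add, Finset.sum_add_distrib, mul_ite, mul_zero,
      Finset.sum_ite_eq', Finset.mem_univ, if_true, Finset.sum_ite_irrel,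
      Finset.sum_const_zero, eq_comm (a := b)]
  rw [← h, Matrix.mul_apply]
  have h1 : ∀ m, typeBMatrix c G i a m * typeBMatrix c G j m b =
      (if a = m then (G i a + (if a = i then c i + ∑ m, G i m else 0)) *
        typeBMatrix c G j m b else 0) +
      (if a = i then G m i * typeBMatrix c G j m b else 0) +
      (if m = i then G a i * typeBMatrix c G j m b else 0) := by
    intro m
    rw [typeBMatrix, Matrix.of_apply]
    simp only [add_mul, ite_mul, zero_mul]
  simp only [h1, Finset.sum_add_distrib, Finset.sum_ite_eq, Finset.sum_ite_eq', Finset.mem_univ,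
    if_true, Finset.sum_ite_irrel, Finset.sum_const_zero]

/-- Entries with exactly one index outside {i, j} reduce to the three-term relation `h3`. In the (i,
j) entry the relations `h3'`, summed over the N − 2 indices m outside {i, j}, give (N − 2) r², and
`hc` adds the contribution rμ of the diagonal terms c. The squares G_ij² + G_ji² left by the sum are
exactly the (i, j) entry of the second product. -/
theorem typeBMatrix_commutator {N : ℕ} {c : Fin N → ℂ} {G : Fin N → Fin N → ℂ} {r μ : ℂ}
    (h0 : ∀ i, G i i = 0)
    (h3 : ∀ i j k, i ≠ j → i ≠ k → j ≠ k → G k i * G j k + G j i * G k j = G j i * G k i)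
    (h3' : ∀ i j m, i ≠ j → m ≠ i → m ≠ j →
      G i m * G i j + G j m * G j i + G m i * G m j = r ^ 2)
    (hc : ∀ i j, i ≠ j → c i * G i j + c j * G j i = r * μ) {i j : Fin N} (hij : i ≠ j) :
    typeBMatrix c G i * typeBMatrix c G j - typeBMatrix c G j * typeBMatrix c G i =
      (r * μ + (N - 2) * r ^ 2) • (Matrix.single i j 1 - Matrix.single j i 1) := by
  have hs : ∀ i j, i ≠ j → (∑ m, G i m) * G i j + (∑ m, G j m) * G j i + ∑ m, G m i * G m j =
      G i j ^ 2 + G j i ^ 2 + (N - 2) * r ^ 2 := by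
    intro i j hij
    rw [Finset.sum_mul, Finset.sum_mul, ← Finset.sum_add_distrib, ← Finset.sum_add_distrib]
    -- The relation `h3'` excludes m = i and m = j, where the summand is G_ji² and G_ij²
    -- respectively because G vanishes on the diagonal.
    have : ∀ m, G i m * G i j + G j m * G j i + G m i * G m j =
        r ^ 2 + (if m = i then G j i ^ 2 - r ^ 2 else 0) +
          (if m = j then G i j ^ 2 - r ^ 2 else 0) := by
      intro m
      by_cases h1 : m = i
      · subst h1
        simp [hij, h0]
        ring
      · by_cases h2 : m = j
        · subst h2
          simp [h1, h0]
          ring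
        · simp [h1, h2, h3' i j m hij h1 h2]
    simp only [this, Finset.sum_add_distrib, Finset.sum_ite_eq', Finset.mem_univ, if_true,
      Finset.sum_const, Finset.card_univ, Fintype.card_fin, nsmul_eq_mul]
    ring
  have hsij := hs i j hij
  have hcij := hc i j hij
  have hsw : ∑ m, G m j * G m i = ∑ m, G m i * G m j := by simp only [mul_comm]
  ext a b
  rw [Matrix.sub_apply, typeBMatrix_mul_apply, typeBMatrix_mul_apply, hsw]
  simp only [typeBMatrix, Matrix.of_apply, Matrix.smul_apply, Matrix.sub_apply, Matrix.single_apply, smul_eq_mul]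
  have hji := hij.symm
  by_cases h1 : a = i
  · subst h1
    by_cases h2 : b = a
    · subst h2
      simp [hij, hji, h0]
      ring
    · by_cases h4 : b = j
      · subst h4
        simp [hij, hji, h0]
        linear_combination hsij + hcij
      · have h5 := h3 a j b hij (Ne.symm h2) (Ne.symm h4)
        simp [hij, hji, h0, h2, h4, Ne.symm h2, Ne.symm h4]
        linear_combination h5
  · by_cases h1' : a = j
    · subst h1'
      by_cases h2 : b = i
      · subst h2
        simp [hij, hji, h0]
        linear_combination -hsij - hcij
      · by_cases h4 : b = a
        · subst h4
          simp [hij, hji, h0]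
          ring
        · have h5 := h3 a i b hji (Ne.symm h4) (Ne.symm h2)
          simp [hij, hji, h0, h2, h4, Ne.symm h2, Ne.symm h4]
          linear_combination -h5
    · by_cases h2 : b = i
      · subst h2
        have h5 := h3 b j a hij (Ne.symm h1) (Ne.symm h1')
        simp [hij, hji, h1, h1', Ne.symm h1, Ne.symm h1']
        linear_combination -h5
      · by_cases h4 : b = j
        · subst h4
          have h5 := h3 b i a hji (Ne.symm h1') (Ne.symm h1)
          simp [hij, hji, h1, h1', Ne.symm h1, Ne.symm h1']
          linear_combination h5
        · simp [h1, h1', h2, h4, Ne.symm h1, Ne.symm h1', Ne.symm h2, Ne.symm h4]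
          split_ifs <;> ring

/-! ### Structure matrices and curvature for B_N and C_N. -/

theorem mem_withNeg {N : ℕ} {S : Finset (Fin N → ℝ)} {β : Fin N → ℝ} :
    β ∈ withNeg S ↔ β ∈ S ∨ -β ∈ S := by
  simp only [withNeg, Finset.mem_union, Finset.mem_image]
  refine or_congr_right ⟨?_, fun h => ⟨_, h, neg_neg β⟩⟩
  rintro ⟨v, hv, rfl⟩
  rwa [neg_neg]

open Classical in
/-- The vectors `s e^i` and `e^i ± e^j`, `i < j`. -/
def halfRoots (N : ℕ) (s : ℝ) : Finset (Fin N → ℝ) :=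
  Finset.univ.image (fun i : Fin N => s • e i) ∪ pairVectors N

theorem mem_halfRoots {N : ℕ} {s : ℝ} {β : Fin N → ℝ} : β ∈ halfRoots N s ↔
    (∃ i, β = s • e i) ∨ ∃ i j, i < j ∧ (β = e i + e j ∨ β = e i - e j) := by
  simp only [halfRoots, pairVectors, Finset.mem_union, Finset.mem_image, Finset.mem_filter,
    Finset.mem_univ, true_and, Prod.exists]
  grind

theorem sum_halfRoots {N : ℕ} {s : ℝ} (hs : s ≠ 0) (f : (Fin N → ℝ) → ℂ) :
    ∑ β ∈ halfRoots N s, f β = ∑ i, f (s • e i) +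
      ∑ ab : Fin N × Fin N with ab.1 < ab.2, (f (e ab.1 + e ab.2) + f (e ab.1 - e ab.2)) := by
  have he : ∀ i j : Fin N, (e i : Fin N → ℝ) j = if j = i then 1 else 0 := by
    intro i j; simp [e, Pi.single_apply]
  rw [halfRoots, pairVectors, Finset.sum_union, Finset.sum_union, Finset.sum_image,
    Finset.sum_image, Finset.sum_image, Finset.sum_add_distrib]
  · rintro ⟨a, b⟩ hab ⟨c, d⟩ hcd h
    simp at hab hcd h
    have h1 := congrFun h a
    have h2 := congrFun h b
    have h3 := congrFun h c
    have h4 := congrFun h d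
    simp only [Pi.sub_apply, he] at h1 h2 h3 h4
    grind
  · rintro ⟨a, b⟩ hab ⟨c, d⟩ hcd h
    simp at hab hcd h
    have h1 := congrFun h a
    have h2 := congrFun h b
    have h3 := congrFun h c
    have h4 := congrFun h d
    simp only [Pi.add_apply, he] at h1 h2 h3 h4
    grind
  · intro a _ b _ h
    have h1 := congrFun h a
    simp only [Pi.smul_apply, he, smul_eq_mul] at h1
    grind
  · rw [Finset.disjoint_left]
    simp only [Finset.mem_image, Finset.mem_filter, Finset.mem_univ, true_and, Prod.exists]
    rintro _ ⟨a, b, hab, rfl⟩ ⟨c, d, hcd, h⟩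
    have h1 := congrFun h a
    have h2 := congrFun h b
    have h3 := congrFun h c
    have h4 := congrFun h d
    simp only [Pi.add_apply, Pi.sub_apply, he] at h1 h2 h3 h4
    grind
  · rw [Finset.disjoint_left]
    simp only [Finset.mem_union, Finset.mem_image, Finset.mem_filter, Finset.mem_univ, true_and,
      Prod.exists]
    rintro _ ⟨a, rfl⟩ (⟨c, d, hcd, h⟩ | ⟨c, d, hcd, h⟩)
    all_goals
      have h3 := congrFun h c
      have h4 := congrFun h d
      simp only [Pi.add_apply, Pi.sub_apply, Pi.smul_apply, smul_eq_mul, he] at h3 h4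
      grind

/-- Converts the sum over pairs a < b into the free double sum from which the row sums ∑ G i m of
`typeBMatrix` arise. -/
theorem sum_lt_add_swap {N : ℕ} (h : Fin N → Fin N → ℂ) (h0 : ∀ a, h a a = 0) :
    ∑ ab : Fin N × Fin N with ab.1 < ab.2, (h ab.1 ab.2 + h ab.2 ab.1) = ∑ a, ∑ b, h a b := by
  simp only [Finset.sum_filter, Fintype.sum_prod_type]
  have h1 : ∀ a b, h a b = (if a < b then h a b else 0) + (if b < a then h a b else 0) := by
    intro a b
    rcases lt_trichotomy a b with h | rfl | h
    · simp [h, h.le]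
    · simp [h0]
    · simp [h, h.le]
  have h2 : ∀ a b, (if a < b then h a b + h b a else 0) =
      (if a < b then h a b else 0) + (if a < b then h b a else 0) := by
    intro a b; split_ifs <;> simp
  conv_rhs => enter [2, a, 2, b]; rw [h1]
  simp only [h2, Finset.sum_add_distrib]
  congr 1
  exact Finset.sum_comm

theorem pair_e {N : ℕ} (i : Fin N) (x : Fin N → ℂ) : pair (e i) x = x i := by
  have : cvec (e i) = Pi.single i 1 := by
    ext j
    simp only [cvec, e, Pi.single_apply]
    split_ifs <;> simp
  simp [pair, this]

theorem pair_add_left {N : ℕ} (β δ : Fin N → ℝ) (x : Fin N → ℂ) :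
    pair (β + δ) x = pair β x + pair δ x := by
  simp [pair, cvec, dotProduct, add_mul, Finset.sum_add_distrib]

theorem pair_sub_left {N : ℕ} (β δ : Fin N → ℝ) (x : Fin N → ℂ) :
    pair (β - δ) x = pair β x - pair δ x := by
  simp [pair, cvec, dotProduct, sub_mul, Finset.sum_sub_distrib]

theorem pair_smul_left {N : ℕ} (s : ℝ) (β : Fin N → ℝ) (x : Fin N → ℂ) :
    pair (s • β) x = s * pair β x := by
  simp [pair, cvec, dotProduct, Finset.mul_sum, mul_assoc]

theorem coth_neg (z : ℂ) : coth (-z) = -coth z := by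
  simp [coth, div_neg]

theorem cosh_two_mul_sub (a b : ℂ) : Complex.cosh (2 * a) - Complex.cosh (2 * b) =
    2 * Complex.sinh (a + b) * Complex.sinh (a - b) := by
  rw [Complex.cosh_two_mul, Complex.cosh_two_mul, Complex.sinh_add, Complex.sinh_sub]
  linear_combination (1 + 2 * Complex.sinh b ^ 2) * Complex.cosh_sq_sub_sinh_sq a -
    (1 + 2 * Complex.sinh a ^ 2) * Complex.cosh_sq_sub_sinh_sq b

theorem coth_add_add_coth_sub {a b : ℂ} (h1 : Complex.sinh (a + b) ≠ 0)
    (h2 : Complex.sinh (a - b) ≠ 0) : coth (a + b) + coth (a - b) =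
      2 * Complex.sinh (2 * a) / (Complex.cosh (2 * a) - Complex.cosh (2 * b)) := by
  rw [cosh_two_mul_sub, coth, coth, div_add_div _ _ h1 h2,
    show 2 * a = (a + b) + (a - b) by ring, Complex.sinh_add (a + b)]
  field_simp
  ring

/-- The roots e_a ± e_b enter only through coth(x_a + x_b) ± coth(x_a − x_b). Up to the factor r/2
these are G_ab and G_ba, whose common denominator depends only on the cosh 2x_a. -/
theorem structMatrix_halfRoots {N : ℕ} {R : Finset (Fin N → ℝ)} {s : ℝ} (hs : s ≠ 0)
    {p q : ℂ} {x : Fin N → ℂ} (hx : IsRegular (halfRoots N s) x) {w r : ℂ}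
    (hw : ∀ i, weight R p q (s • e i) = w)
    (hr : ∀ i j, i < j → weight R p q (e i + e j) = r / 2 ∧ weight R p q (e i - e j) = r / 2)
    (i : Fin N) : structMatrix R (halfRoots N s) p q x (Pi.single i 1) =
      typeBMatrix (fun a => w * s ^ 3 * coth (s * x a)) (fun a b => r * Complex.sinh (2 * x a) /
        (Complex.cosh (2 * x a) - Complex.cosh (2 * x b))) i := by
  set G : Fin N → Fin N → ℂ := fun a b => r * Complex.sinh (2 * x a) /
        (Complex.cosh (2 * x a) - Complex.cosh (2 * x b)) with hG
  have hG0 : ∀ a, G a a = 0 := by intro a; simp [hG]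
  have hp : ∀ a b : Fin N, a < b →
      Complex.sinh (x a + x b) ≠ 0 ∧ Complex.sinh (x a - x b) ≠ 0 := by
    intro a b hab
    have h1 := hx (e a + e b) (mem_halfRoots.2 (Or.inr ⟨a, b, hab, Or.inl rfl⟩))
    have h2 := hx (e a - e b) (mem_halfRoots.2 (Or.inr ⟨a, b, hab, Or.inr rfl⟩))
    rw [pair_add_left, pair_e, pair_e] at h1
    rw [pair_sub_left, pair_e, pair_e] at h2
    exact ⟨h1, h2⟩
  have hA : ∀ a b : Fin N, a < b → r / 2 * (coth (x a + x b) + coth (x a - x b)) = G a b := by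
    intro a b hab
    rw [coth_add_add_coth_sub (hp a b hab).1 (hp a b hab).2]
    simp only [hG]
    ring
  have hB : ∀ a b : Fin N, a < b → r / 2 * (coth (x a + x b) - coth (x a - x b)) = G b a := by
    intro a b hab
    have h2 : Complex.sinh (x b - x a) ≠ 0 := by
      rw [← neg_sub, Complex.sinh_neg]
      exact neg_ne_zero.2 (hp a b hab).2
    rw [← neg_sub (x b) (x a), coth_neg, sub_neg_eq_add, add_comm (x a),
      coth_add_add_coth_sub (by rw [add_comm]; exact (hp a b hab).1) h2]
    simp only [hG]
    ring
  let d : Fin N → Fin N → ℂ := fun a j => if a = j then 1 else 0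
  have he : ∀ a j : Fin N, (((e a : Fin N → ℝ) j : ℝ) : ℂ) = d a j := by
    intro a j
    simp only [e, Pi.single_apply, d, eq_comm (a := a)]
    split_ifs <;> simp
  ext j k
  -- In the tensor cubes of e_a ± e_b, the terms even in e_b have the same sign for both roots and
  -- carry G_ab; those odd in e_b carry G_ba. H collects the former, and its swap the latter.
  let H : Fin N → Fin N → ℂ := fun a b => G a b * (d a i * d a j * d a k + d a i * d b j * d b k +
    d b i * d a j * d b k + d b i * d b j * d a k)
  rw [structMatrix_single_apply, sum_halfRoots hs]
  have h1 : ∀ ab ∈ (Finset.univ.filter fun ab : Fin N × Fin N => ab.1 < ab.2),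
      (weight R p q (e ab.1 + e ab.2) * ((e ab.1 + e ab.2) i : ℝ) * ((e ab.1 + e ab.2) j : ℝ) *
        ((e ab.1 + e ab.2) k : ℝ) * coth (pair (e ab.1 + e ab.2) x) +
      weight R p q (e ab.1 - e ab.2) * ((e ab.1 - e ab.2) i : ℝ) * ((e ab.1 - e ab.2) j : ℝ) *
        ((e ab.1 - e ab.2) k : ℝ) * coth (pair (e ab.1 - e ab.2) x)) =
      H ab.1 ab.2 +
      H ab.2 ab.1 := by
    rintro ⟨a, b⟩ hab
    simp only [Finset.mem_filter, Finset.mem_univ, true_and] at hab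
    simp only [(hr a b hab).1, (hr a b hab).2, Pi.add_apply, Pi.sub_apply, Complex.ofReal_add,
      Complex.ofReal_sub, H, he, pair_add_left, pair_sub_left, pair_e, ← hA a b hab, ← hB a b hab]
    ring
  rw [Finset.sum_congr rfl h1, sum_lt_add_swap H (fun a => by simp only [H, hG0, zero_mul])]
  simp only [hw, Pi.smul_apply, smul_eq_mul, Complex.ofReal_mul, he, pair_smul_left, pair_e]
  simp only [H, d, typeBMatrix, Matrix.of_apply, mul_ite, ite_mul, mul_one, mul_zero, zero_mul,
    mul_add, Finset.sum_add_distrib, Finset.sum_ite_eq', Finset.mem_univ, if_true,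
    Finset.sum_ite_irrel, Finset.sum_const_zero]
  by_cases h2 : j = i
  · subst h2
    by_cases h3 : k = j
    · subst h3
      simp [hG0]
      left
      ring
    · simp [h3, Ne.symm h3]
  · by_cases h3 : k = i
    · subst h3
      simp [h2, Ne.symm h2]
    · by_cases h4 : j = k
      · subst h4
        simp [h2]
      · simp [h2, h3, h4, Ne.symm h4]

/-- Up to r², the sum is the second divided difference of t² − 1 at a, b, c, which is its leading
coefficient 1. -/
theorem divided_difference_sq {a b c u v w r : ℂ} (hu : u ^ 2 = a ^ 2 - 1)
    (hv : v ^ 2 = b ^ 2 - 1) (hw : w ^ 2 = c ^ 2 - 1) (hab : a - b ≠ 0) (hac : a - c ≠ 0)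
    (hbc : b - c ≠ 0) :
    r * u / (a - c) * (r * u / (a - b)) + r * v / (b - c) * (r * v / (b - a)) +
      r * w / (c - a) * (r * w / (c - b)) = r ^ 2 := by
  have h : r * u / (a - c) * (r * u / (a - b)) + r * v / (b - c) * (r * v / (b - a)) +
      r * w / (c - a) * (r * w / (c - b)) = r ^ 2 * (u ^ 2 / ((a - c) * (a - b)) +
        v ^ 2 / ((b - c) * (b - a)) + w ^ 2 / ((c - a) * (c - b))) := by
    rw [div_mul_div_comm, div_mul_div_comm, div_mul_div_comm]
    ring
  have h1 : b - a ≠ 0 := by rw [← neg_sub]; exact neg_ne_zero.2 hab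
  have h2 : c - a ≠ 0 := by rw [← neg_sub]; exact neg_ne_zero.2 hac
  have h3 : c - b ≠ 0 := by rw [← neg_sub]; exact neg_ne_zero.2 hbc
  rw [h, hu, hv, hw]
  field_simp
  ring

/-- Set t_a = cosh 2x_a, so that sinh² 2x_a = t_a² − 1. The hypothesis `hμ` makes c_a sinh 2x_a
affine in t_a with slope μ, so c_i G_ij + c_j G_ji is r times a first divided difference, namely rμ.
The shift ν drops out. -/
theorem hasCurvature_halfRoots {N : ℕ} {R : Finset (Fin N → ℝ)} {s : ℝ} (hs : s ≠ 0)
    {p q : ℂ} {x : Fin N → ℂ} (hx : IsRegular (halfRoots N s) x) {w r μ ν : ℂ}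
    (hw : ∀ i, weight R p q (s • e i) = w)
    (hr : ∀ i j, i < j → weight R p q (e i + e j) = r / 2 ∧ weight R p q (e i - e j) = r / 2)
    (hμ : ∀ a, Complex.sinh (s * x a) ≠ 0 → w * s ^ 3 * coth (s * x a) * Complex.sinh (2 * x a) =
      μ * (Complex.cosh (2 * x a) + ν)) :
    HasCurvature R (halfRoots N s) p q x (r * μ + (N - 2) * r ^ 2) := by
  intro i j hij
  rw [structMatrix_halfRoots hs hx hw hr, structMatrix_halfRoots hs hx hw hr]
  -- The difference factors as 2 sinh(x_a + x_b) sinh(x_a − x_b), non-zero at regular points.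
  have hk : ∀ a b : Fin N, a ≠ b → Complex.cosh (2 * x a) - Complex.cosh (2 * x b) ≠ 0 := by
    have : ∀ a b : Fin N, a < b → Complex.cosh (2 * x a) - Complex.cosh (2 * x b) ≠ 0 := by
      intro a b hab
      have h1 := hx (e a + e b) (mem_halfRoots.2 (Or.inr ⟨a, b, hab, Or.inl rfl⟩))
      have h2 := hx (e a - e b) (mem_halfRoots.2 (Or.inr ⟨a, b, hab, Or.inr rfl⟩))
      rw [pair_add_left, pair_e, pair_e] at h1
      rw [pair_sub_left, pair_e, pair_e] at h2
      rw [cosh_two_mul_sub]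
      exact mul_ne_zero (mul_ne_zero two_ne_zero h1) h2
    intro a b hab
    rcases lt_or_gt_of_ne hab with h | h
    · exact this a b h
    · rw [← neg_sub]
      exact neg_ne_zero.2 (this b a h)
  refine typeBMatrix_commutator ?_ ?_ ?_ ?_ hij
  · intro a; simp
  · intro i j k hij hik hjk
    have h1 := hk k i hik.symm
    have h2 := hk j k hjk
    have h3 := hk j i hij.symm
    have h4 := hk k j hjk.symm
    field_simp
    ring
  · intro i j m hij hmi hmj
    have h1 := hk i m hmi.symm
    have h2 := hk i j hij
    have h3 := hk j m hmj.symm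
    have hS : ∀ a, Complex.sinh (2 * x a) ^ 2 = Complex.cosh (2 * x a) ^ 2 - 1 := fun a =>
      Complex.sinh_sq _
    exact divided_difference_sq (hS i) (hS j) (hS m) h2 h1 h3
  · intro i j hij
    have h1 := hk i j hij
    have hn : ∀ a, Complex.sinh (s * x a) ≠ 0 := by
      intro a
      have := hx (s • e a) (mem_halfRoots.2 (Or.inl ⟨a, rfl⟩))
      rwa [pair_smul_left, pair_e] at this
    have hi := hμ i (hn i)
    have hj := hμ j (hn j)
    rw [show Complex.cosh (2 * x j) - Complex.cosh (2 * x i) =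
      -(Complex.cosh (2 * x i) - Complex.cosh (2 * x j)) by ring, div_neg, mul_neg,
      mul_div_assoc', mul_div_assoc', ← sub_eq_add_neg, ← sub_div, div_eq_iff h1]
    linear_combination r * hi - r * hj

/-! ### Lengths, weights and coweights for B_N and C_N. -/

theorem dotProduct_e {N : ℕ} (v : Fin N → ℝ) (i : Fin N) : v ⬝ᵥ e i = v i := by
  simp [e]

theorem e_dotProduct {N : ℕ} (v : Fin N → ℝ) (i : Fin N) : e i ⬝ᵥ v = v i := by
  simp [e]

theorem e_apply {N : ℕ} (i j : Fin N) : (e i : Fin N → ℝ) j = if j = i then 1 else 0 := by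
  simp [e, Pi.single_apply]

theorem smul_e_dotProduct_self {N : ℕ} (s : ℝ) (i : Fin N) :
    (s • e i : Fin N → ℝ) ⬝ᵥ (s • e i) = s ^ 2 := by
  simp [dotProduct_e, e_apply, pow_two]

theorem e_add_e_dotProduct_self {N : ℕ} {i j : Fin N} (h : i ≠ j) :
    (e i + e j : Fin N → ℝ) ⬝ᵥ (e i + e j) = 2 := by
  simp [add_dotProduct, e_dotProduct, e_apply, h, h.symm]
  norm_num

theorem e_sub_e_dotProduct_self {N : ℕ} {i j : Fin N} (h : i ≠ j) :
    (e i - e j : Fin N → ℝ) ⬝ᵥ (e i - e j) = 2 := by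
  simp [sub_dotProduct, e_dotProduct, e_apply, h, h.symm]
  norm_num

theorem dotProduct_self_of_mem_withNeg_halfRoots {N : ℕ} {s : ℝ} {β : Fin N → ℝ}
    (h : β ∈ withNeg (halfRoots N s)) : β ⬝ᵥ β = s ^ 2 ∨ β ⬝ᵥ β = 2 := by
  have h1 : ∀ β ∈ halfRoots N s, β ⬝ᵥ β = s ^ 2 ∨ β ⬝ᵥ β = 2 := by
    intro β hβ
    rcases mem_halfRoots.1 hβ with ⟨i, rfl⟩ | ⟨i, j, hij, rfl | rfl⟩
    · exact Or.inl (smul_e_dotProduct_self s i)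
    · exact Or.inr (e_add_e_dotProduct_self hij.ne)
    · exact Or.inr (e_sub_e_dotProduct_self hij.ne)
  rcases mem_withNeg.1 h with h | h
  · exact h1 β h
  · simpa using h1 _ h

theorem rootsB_eq (N : ℕ) : rootsB N = withNeg (halfRoots N 1) := by
  simp [rootsB, halfRoots]

theorem rootsC_eq (N : ℕ) : rootsC N = withNeg (halfRoots N 2) := rfl

/-- The partial sums of coordinates. -/
def partialSum {N : ℕ} (i : Fin N) : Fin N → ℝ := fun j => if j ≤ i then 1 else 0

/-- The partial sums are the basis dual to the simple roots of B_N; for C_N only the last one must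
be halved. On e_a − e_b with a < b they take the value 1 exactly for a ≤ i < b. -/
theorem exists_nat_partialSum {N : ℕ} {s : ℕ} {β : Fin N → ℝ} (h : β ∈ halfRoots N s)
    (i : Fin N) : ∃ m : ℕ, partialSum i ⬝ᵥ β = m := by
  rcases mem_halfRoots.1 h with ⟨a, rfl⟩ | ⟨a, b, hab, rfl | rfl⟩
  · refine ⟨if a ≤ i then s else 0, ?_⟩
    simp [dotProduct_e, partialSum]
  · refine ⟨(if a ≤ i then 1 else 0) + (if b ≤ i then 1 else 0), ?_⟩
    simp [dotProduct_add, dotProduct_e, partialSum]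
  · refine ⟨if a ≤ i ∧ i < b then 1 else 0, ?_⟩
    simp only [dotProduct_sub, dotProduct_e, partialSum]
    by_cases h1 : a ≤ i <;> by_cases h2 : b ≤ i
    · simp [h1, h2]
    · simp [h1, h2, lt_of_not_ge h2]
    · exact absurd (hab.le.trans h2) h1
    · simp [h1, h2]

theorem dotProduct_descending_pos {N : ℕ} {s : ℝ} (hs : 0 < s) {β : Fin N → ℝ}
    (h : β ∈ halfRoots N s) : 0 < β ⬝ᵥ (fun i : Fin N => (N : ℝ) - i.val) := by
  have hp : ∀ i : Fin N, 0 < (N : ℝ) - i.val := fun i => sub_pos.2 (Nat.cast_lt.2 i.isLt)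
  rcases mem_halfRoots.1 h with ⟨a, rfl⟩ | ⟨a, b, hab, rfl | rfl⟩
  · rw [smul_dotProduct, e_dotProduct]
    exact mul_pos hs (hp a)
  · rw [add_dotProduct, e_dotProduct, e_dotProduct]
    exact add_pos (hp a) (hp b)
  · rw [sub_dotProduct, e_dotProduct, e_dotProduct]
    have : (a.val : ℝ) < b.val := Nat.cast_lt.2 hab
    linarith

theorem weight_of_minimal {N : ℕ} {R : Finset (Fin N → ℝ)} {p q : ℂ} {β : Fin N → ℝ}
    (h : ∀ δ ∈ R, β ⬝ᵥ β ≤ δ ⬝ᵥ δ) : weight R p q β = p / ((β ⬝ᵥ β : ℝ) : ℂ) := by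
  rw [weight, mult, if_pos h]

theorem weight_of_not_minimal {N : ℕ} {R : Finset (Fin N → ℝ)} {p q : ℂ} {β δ : Fin N → ℝ}
    (hδ : δ ∈ R) (h : δ ⬝ᵥ δ < β ⬝ᵥ β) : weight R p q β = q / ((β ⬝ᵥ β : ℝ) : ℂ) := by
  rw [weight, mult, if_neg fun h' => (h' δ hδ).not_gt h]

theorem partialSum_dotProduct_le_two {N : ℕ} {s : ℝ} (hs : s ≤ 2) {β : Fin N → ℝ}
    (h : β ∈ halfRoots N s) (i : Fin N) : partialSum i ⬝ᵥ β ≤ 2 := by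
  rcases mem_halfRoots.1 h with ⟨a, rfl⟩ | ⟨a, b, hab, rfl | rfl⟩ <;>
  simp only [dotProduct_add, dotProduct_sub, dotProduct_smul, dotProduct_e, partialSum,
    smul_eq_mul] <;> split_ifs <;> linarith

theorem hasCurvature_rootsB {N : ℕ} (p q : ℂ) {x : Fin N → ℂ}
    (hx : IsRegular (halfRoots N 1) x) :
    HasCurvature (rootsB N) (halfRoots N 1) p q x (p * q + (N - 2) * q ^ 2) := by
  have hmem : ∀ β ∈ halfRoots N 1, β ∈ rootsB N := fun β hβ => by
    rw [rootsB_eq]; exact mem_withNeg.2 (Or.inl hβ)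
  have h1 : ∀ i : Fin N, e i ∈ rootsB N := fun i =>
    hmem _ (mem_halfRoots.2 (Or.inl ⟨i, (one_smul _ _).symm⟩))
  have hn : ∀ i : Fin N, (e i : Fin N → ℝ) ⬝ᵥ e i = 1 := fun i => by simp [dotProduct_e, e_apply]
  have hw : ∀ i : Fin N, weight (rootsB N) p q ((1 : ℝ) • e i) = p := by
    intro i
    rw [one_smul, weight_of_minimal, hn]
    · simp
    · intro δ hδ
      rw [rootsB_eq] at hδ
      rw [hn]
      rcases dotProduct_self_of_mem_withNeg_halfRoots hδ with h | h <;> rw [h] <;> norm_num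
  have hr : ∀ i j : Fin N, i < j → weight (rootsB N) p q (e i + e j) = q / 2 ∧
      weight (rootsB N) p q (e i - e j) = q / 2 := by
    intro i j hij
    constructor
    · rw [weight_of_not_minimal (h1 i), e_add_e_dotProduct_self hij.ne]
      · norm_num
      · rw [e_add_e_dotProduct_self hij.ne, hn]; norm_num
    · rw [weight_of_not_minimal (h1 i), e_sub_e_dotProduct_self hij.ne]
      · norm_num
      · rw [e_sub_e_dotProduct_self hij.ne, hn]; norm_num
  rw [mul_comm p]
  -- Here coth z sinh 2z = 2 cosh² z = cosh 2z + 1, so μ = p, ν = 1 and r = q.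
  refine hasCurvature_halfRoots (ν := 1) one_ne_zero hx hw hr fun a ha => ?_
  rw [Complex.ofReal_one, one_mul] at *
  rw [coth, Complex.sinh_two_mul, Complex.cosh_two_mul]
  field_simp
  rw [Complex.sinh_sq]
  ring

theorem hasCurvature_rootsC {N : ℕ} (hN : 2 ≤ N) (p q : ℂ) {x : Fin N → ℂ}
    (hx : IsRegular (halfRoots N 2) x) :
    HasCurvature (rootsC N) (halfRoots N 2) p q x (2 * (p * q) + (N - 2) * p ^ 2) := by
  have hmin : ∀ β : Fin N → ℝ, β ⬝ᵥ β = 2 → ∀ δ ∈ rootsC N, β ⬝ᵥ β ≤ δ ⬝ᵥ δ := by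
    intro β hβ δ hδ
    rw [rootsC_eq] at hδ
    rw [hβ]
    rcases dotProduct_self_of_mem_withNeg_halfRoots hδ with h | h <;> rw [h]
    norm_num
  have hw : ∀ i : Fin N, weight (rootsC N) p q ((2 : ℝ) • e i) = q / 4 := by
    intro i
    -- N ≥ 2 supplies the short root e^1 + e^2, without which 2e^i would be of minimal length.
    have hij : (⟨0, by omega⟩ : Fin N) < ⟨1, by omega⟩ := by simp
    rw [weight_of_not_minimal (δ := e ⟨0, by omega⟩ + e ⟨1, by omega⟩),
      smul_e_dotProduct_self]
    · norm_num
    · rw [rootsC_eq]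
      exact mem_withNeg.2 (Or.inl (mem_halfRoots.2 (Or.inr ⟨_, _, hij, Or.inl rfl⟩)))
    · rw [smul_e_dotProduct_self, e_add_e_dotProduct_self hij.ne]
      norm_num
  have hr : ∀ i j : Fin N, i < j → weight (rootsC N) p q (e i + e j) = p / 2 ∧
      weight (rootsC N) p q (e i - e j) = p / 2 := by
    intro i j hij
    have h1 := e_add_e_dotProduct_self hij.ne
    have h2 := e_sub_e_dotProduct_self hij.ne
    rw [weight_of_minimal (hmin _ h1), weight_of_minimal (hmin _ h2), h1, h2]
    norm_num
  rw [show 2 * (p * q) = p * (2 * q) by ring]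
  -- Here w s³ = (q/4)·8 = 2q and coth 2z sinh 2z = cosh 2z, so μ = 2q and ν = 0.
  refine hasCurvature_halfRoots (ν := 0) two_ne_zero hx hw hr fun a ha => ?_
  rw [Complex.ofReal_ofNat] at *
  rw [coth]
  field_simp
  ring

theorem gammaFormula_rootsB (p q : ℂ) {N : ℕ} (hN : 2 ≤ N) :
    GammaFormula (rootsB N) (simpleB N) p q (p * q)
      (fun i => if i.val = 0 ∨ i.val + 1 = N then p * q else q ^ 2) := by
  have h01 : (⟨0, by omega⟩ : Fin N) < ⟨1, by omega⟩ := by simp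
  -- The highest root is e^1 + e^2 = α_1 + 2α_2 + … + 2α_N; the vector (N, …, 2, 1) is positive on
  -- the positive roots.
  refine gammaFormula_of_hasCurvature hN (P := halfRoots N 1) partialSum
    (fun i => (N : ℝ) - i.val) (e ⟨0, by omega⟩ + e ⟨1, by omega⟩)
    (fun i => if i.val = 0 then 1 else 2) _ ?_ ?_ ?_ ?_ ?_ ?_ ?_ ?_
    (fun x hx => hasCurvature_rootsB p q hx) ?_
  · intro i j
    rw [simpleB]
    split_ifs <;> simp only [dotProduct_sub, dotProduct_e, partialSum, Fin.le_def] <;> grind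
  · intro β
    rw [rootsB_eq, mem_withNeg]
  · intro β hβ i
    exact exists_nat_partialSum (s := 1) (by simpa using hβ) i
  · intro β hβ
    exact dotProduct_descending_pos one_pos hβ
  · intro i
    rw [mem_halfRoots, simpleB]
    split_ifs with h
    · exact Or.inr ⟨_, _, Fin.lt_def.2 (Nat.lt_succ_self _), Or.inr rfl⟩
    · exact Or.inl ⟨i, (one_smul _ _).symm⟩
  · exact mem_halfRoots.2 (Or.inr ⟨_, _, h01, Or.inl rfl⟩)
  · intro i
    simp only [dotProduct_add, dotProduct_e, partialSum, Fin.le_def]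
    by_cases h : i.val = 0
    · simp [h]
    · simp [h, Nat.one_le_iff_ne_zero]
      norm_num
  · intro β hβ i
    by_cases h : i.val = 0
    · have : ∀ a b : Fin N, a < b → ¬ b ≤ i := by
        intro a b hab hb
        rw [Fin.le_def] at hb
        rw [Fin.lt_def] at hab
        omega
      simp only [h, if_true, Int.cast_one]
      rcases mem_halfRoots.1 hβ with ⟨a, rfl⟩ | ⟨a, b, hab, rfl | rfl⟩ <;>
      simp only [dotProduct_add, dotProduct_sub, dotProduct_smul, dotProduct_e, partialSum,
        smul_eq_mul]
      · split_ifs <;> norm_num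
      · rw [if_neg (this a b hab)]
        split_ifs <;> norm_num
      · rw [if_neg (this a b hab)]
        split_ifs <;> norm_num
    · simpa [h] using partialSum_dotProduct_le_two one_le_two hβ i
  · rw [e_add_e_dotProduct_self h01.ne]
    -- The generic term is q²·4·2; the first index has n = 1 and squared length 2, the last has n =
    -- 2 and squared length 1.
    have hf : ∀ i : Fin N, (if i.val = 0 ∨ i.val + 1 = N then p * q else q ^ 2) *
        (((if i.val = 0 then 1 else 2 : ℤ) : ℂ)) ^ 2 *
        ((simpleB N i ⬝ᵥ simpleB N i : ℝ) : ℂ) = 8 * q ^ 2 +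
        (if i = ⟨0, by omega⟩ then 2 * p * q - 8 * q ^ 2 else 0) +
        (if i = ⟨N - 1, by omega⟩ then 4 * p * q - 8 * q ^ 2 else 0) := by
      intro i
      have hlast : i = ⟨N - 1, by omega⟩ ↔ i.val + 1 = N := by
        rw [Fin.ext_iff]; simp only; omega
      have hfirst : i = ⟨0, by omega⟩ ↔ i.val = 0 := Fin.ext_iff
      by_cases h1 : i.val + 1 < N
      · have h2 : i.val + 1 ≠ N := h1.ne
        rw [simpleB, dif_pos h1, e_sub_e_dotProduct_self (by simp [Fin.ext_iff])]
        simp only [hlast, hfirst, h2, or_false, if_false]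
        split_ifs <;> push_cast <;> ring
      · have h2 : i.val + 1 = N := by omega
        have h3 : i.val ≠ 0 := by omega
        rw [simpleB, dif_neg h1, e_dotProduct, e_apply]
        simp only [hlast, hfirst, h2, h3, or_true, if_true, if_false]
        push_cast
        ring
    simp only [hf, Finset.sum_add_distrib, Finset.sum_ite_eq', Finset.mem_univ, if_true,
      Finset.sum_const, Finset.card_univ, Fintype.card_fin, nsmul_eq_mul]
    push_cast
    ring

theorem gammaFormula_rootsC (p q : ℂ) {N : ℕ} (hN : 2 ≤ N) :
    GammaFormula (rootsC N) (simpleC N) p q (p * q)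
      (fun i => if i.val = 0 ∨ i.val + 1 = N then p * q else p ^ 2) := by
  have hlast : ∀ {i : Fin N} (j : Fin N), i.val + 1 = N → j ≤ i := by
    intro i j h
    rw [Fin.le_def]; omega
  -- The last coweight is halved because α_N = 2e^N, and θ = 2e^1 = 2α_1 + … + 2α_{N−1} + α_N.
  refine gammaFormula_of_hasCurvature hN (P := halfRoots N 2)
    (fun i => (if i.val + 1 = N then (1 / 2 : ℝ) else 1) • partialSum i)
    (fun i => (N : ℝ) - i.val) ((2 : ℝ) • e ⟨0, by omega⟩)
    (fun i => if i.val + 1 = N then 1 else 2) _ ?_ ?_ ?_ ?_ ?_ ?_ ?_ ?_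
    (fun x hx => hasCurvature_rootsC hN p q hx) ?_
  · intro i j
    rw [simpleC]
    split_ifs <;> simp only [dotProduct_sub, dotProduct_smul, smul_dotProduct, dotProduct_e,
      partialSum, Fin.le_def, smul_eq_mul] <;> grind
  · intro β
    rw [rootsC_eq, mem_withNeg]
  · intro β hβ i
    by_cases h : i.val + 1 = N
    · simp only [h, if_true, smul_dotProduct]
      rcases mem_halfRoots.1 hβ with ⟨a, rfl⟩ | ⟨a, b, hab, rfl | rfl⟩
      · refine ⟨1, ?_⟩
        simp [dotProduct_e, partialSum, hlast _ h]
      · refine ⟨1, ?_⟩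
        simp [dotProduct_add, dotProduct_e, partialSum, hlast _ h]
        norm_num
      · refine ⟨0, ?_⟩
        simp [dotProduct_sub, dotProduct_e, partialSum, hlast _ h]
    · simp only [h, if_false, one_smul]
      exact exists_nat_partialSum (s := 2) (by simpa using hβ) i
  · intro β hβ
    exact dotProduct_descending_pos two_pos hβ
  · intro i
    rw [mem_halfRoots, simpleC]
    split_ifs with h
    · exact Or.inr ⟨_, _, Fin.lt_def.2 (Nat.lt_succ_self _), Or.inr rfl⟩
    · exact Or.inl ⟨i, rfl⟩
  · exact mem_halfRoots.2 (Or.inl ⟨_, rfl⟩)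
  · intro i
    simp only [dotProduct_smul, smul_dotProduct, dotProduct_e, partialSum, Fin.le_def,
      Nat.zero_le, if_true, smul_eq_mul]
    split_ifs <;> norm_num
  · intro β hβ i
    have h1 := partialSum_dotProduct_le_two le_rfl hβ i
    simp only [smul_dotProduct, smul_eq_mul]
    split_ifs <;> push_cast <;> linarith
  · rw [smul_e_dotProduct_self]
    have hf : ∀ i : Fin N, (if i.val = 0 ∨ i.val + 1 = N then p * q else p ^ 2) *
        (((if i.val + 1 = N then 1 else 2 : ℤ) : ℂ)) ^ 2 *
        ((simpleC N i ⬝ᵥ simpleC N i : ℝ) : ℂ) = 8 * p ^ 2 +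
        (if i = ⟨0, by omega⟩ then 8 * p * q - 8 * p ^ 2 else 0) +
        (if i = ⟨N - 1, by omega⟩ then 4 * p * q - 8 * p ^ 2 else 0) := by
      intro i
      have hlast : i = ⟨N - 1, by omega⟩ ↔ i.val + 1 = N := by
        rw [Fin.ext_iff]; simp only; omega
      have hfirst : i = ⟨0, by omega⟩ ↔ i.val = 0 := Fin.ext_iff
      by_cases h1 : i.val + 1 < N
      · have h2 : i.val + 1 ≠ N := h1.ne
        rw [simpleC, dif_pos h1, e_sub_e_dotProduct_self (by simp [Fin.ext_iff])]
        simp only [hlast, hfirst, h2, or_false, if_false]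
        split_ifs <;> push_cast <;> ring
      · have h2 : i.val + 1 = N := by omega
        have h3 : i.val ≠ 0 := by omega
        rw [simpleC, dif_neg h1, smul_e_dotProduct_self]
        simp only [hlast, hfirst, h2, h3, or_true, if_true, if_false]
        push_cast
        ring
    simp only [hf, Finset.sum_add_distrib, Finset.sum_ite_eq', Finset.mem_univ, if_true,
      Finset.sum_const, Finset.card_univ, Fintype.card_fin, nsmul_eq_mul]
    push_cast
    ring

/-! ### The root system F_4 in doubled integer coordinates. -/

/-- Half of an integer vector. -/
def halfVec {N : ℕ} (v : Fin N → ℤ) : Fin N → ℝ := fun i => (v i : ℝ) / 2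

/-- The doubles of the positive roots of `F_4`. -/
def doubledF4 : Finset (Fin 4 → ℤ) :=
  ⟨([![2, 0, 0, 0], ![0, 2, 0, 0], ![0, 0, 2, 0], ![0, 0, 0, 2],
    ![2, 2, 0, 0], ![2, -2, 0, 0], ![2, 0, 2, 0], ![2, 0, -2, 0], ![2, 0, 0, 2], ![2, 0, 0, -2],
    ![0, 2, 2, 0], ![0, 2, -2, 0], ![0, 2, 0, 2], ![0, 2, 0, -2], ![0, 0, 2, 2], ![0, 0, 2, -2],
    ![1, 1, 1, 1], ![1, 1, 1, -1], ![1, 1, -1, 1], ![1, 1, -1, -1],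
    ![1, -1, 1, 1], ![1, -1, 1, -1], ![1, -1, -1, 1], ![1, -1, -1, -1]] : List (Fin 4 → ℤ)),
    by decide⟩

open Classical in
/-- The positive roots of `F_4`. -/
def posF4 : Finset (Fin 4 → ℝ) := doubledF4.image halfVec

theorem halfVec_injective {N : ℕ} : Function.Injective (halfVec (N := N)) := by
  intro v w h
  ext i
  have := congrFun h i
  simp only [halfVec] at this
  exact_mod_cast (div_left_inj' two_ne_zero).1 this

/-- Doubling makes the roots integral, so that memberships, norms and coefficients become finite
decidable checks. -/
theorem sum_posF4 (f : (Fin 4 → ℝ) → ℂ) : ∑ β ∈ posF4, f β = ∑ v ∈ doubledF4, f (halfVec v) := by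
  rw [posF4, Finset.sum_image halfVec_injective.injOn]

theorem mem_posF4 {β : Fin 4 → ℝ} : β ∈ posF4 ↔ ∃ v ∈ doubledF4, halfVec v = β := by
  rw [posF4, Finset.mem_image]

theorem halfVec_dotProduct {N : ℕ} (v w : Fin N → ℤ) :
    halfVec v ⬝ᵥ halfVec w = ((v ⬝ᵥ w : ℤ) : ℝ) / 4 := by
  simp only [halfVec, dotProduct, Int.cast_sum, Int.cast_mul, Finset.sum_div]
  exact Finset.sum_congr rfl fun i _ => by ring

theorem e_eq_halfVec {N : ℕ} (i : Fin N) : e i = halfVec (Pi.single i 2) := by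
  ext j
  simp only [e, halfVec, Pi.single_apply]
  split_ifs <;> simp

theorem halfVec_add {N : ℕ} (v w : Fin N → ℤ) : halfVec (v + w) = halfVec v + halfVec w := by
  ext i; simp [halfVec, add_div]

theorem halfVec_sub {N : ℕ} (v w : Fin N → ℤ) : halfVec (v - w) = halfVec v - halfVec w := by
  ext i; simp [halfVec, sub_div]

theorem halfRoots_subset_posF4 {β : Fin 4 → ℝ} (h : β ∈ halfRoots 4 1) : β ∈ posF4 := by
  rw [mem_posF4]
  rcases mem_halfRoots.1 h with ⟨a, rfl⟩ | ⟨a, b, hab, rfl | rfl⟩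
  · refine ⟨_, ?_, (e_eq_halfVec a).symm.trans (one_smul _ _).symm⟩
    clear h; revert a; decide
  · rw [e_eq_halfVec, e_eq_halfVec, ← halfVec_add]
    refine ⟨_, ?_, rfl⟩
    clear h; revert a b; decide
  · rw [e_eq_halfVec, e_eq_halfVec, ← halfVec_sub]
    refine ⟨_, ?_, rfl⟩
    clear h; revert a b; decide

theorem mem_spin {β : Fin 4 → ℝ} :
    β ∈ Fintype.piFinset (fun _ : Fin 4 => ({1 / 2, -(1 / 2)} : Finset ℝ)) ↔
      ∀ i, β i = 1 / 2 ∨ β i = -(1 / 2) := by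
  simp [Fintype.mem_piFinset]

theorem mem_posF4_of_spin {β : Fin 4 → ℝ} (h : ∀ i, β i = 1 / 2 ∨ β i = -(1 / 2))
    (h0 : β 0 = 1 / 2) : β ∈ posF4 := by
  classical
  have key : ∀ s : Fin 4 → Bool, s 0 = true → (fun i => if s i then (1 : ℤ) else -1) ∈ doubledF4 := by
    decide
  refine mem_posF4.2 ⟨_, key (fun i => decide (β i = 1 / 2)) (by simp [h0]), ?_⟩
  ext i
  rcases h i with h | h
  · simp [halfVec, h]
  · rw [halfVec, h]
    norm_num

theorem mem_rootsF4_iff {β : Fin 4 → ℝ} : β ∈ rootsF4 ↔ β ∈ posF4 ∨ -β ∈ posF4 := by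
  have hpos : ∀ β ∈ posF4, β ∈ halfRoots 4 1 ∨ ∀ i, β i = 1 / 2 ∨ β i = -(1 / 2) := by
    intro β hβ
    obtain ⟨v, hv, rfl⟩ := mem_posF4.1 hβ
    have key : ∀ v ∈ doubledF4, (∃ a, v = Pi.single a 2) ∨
        (∃ a b, a < b ∧ (v = Pi.single a 2 + Pi.single b 2 ∨ v = Pi.single a 2 - Pi.single b 2)) ∨
        ∀ i, v i = 1 ∨ v i = -1 := by
      decide
    rcases key v hv with ⟨a, rfl⟩ | ⟨a, b, hab, rfl | rfl⟩ | h
    · exact Or.inl (mem_halfRoots.2 (Or.inl ⟨a, by rw [← e_eq_halfVec, one_smul]⟩))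
    · refine Or.inl (mem_halfRoots.2 (Or.inr ⟨a, b, hab, Or.inl ?_⟩))
      rw [halfVec_add, ← e_eq_halfVec, ← e_eq_halfVec]
    · refine Or.inl (mem_halfRoots.2 (Or.inr ⟨a, b, hab, Or.inr ?_⟩))
      rw [halfVec_sub, ← e_eq_halfVec, ← e_eq_halfVec]
    · refine Or.inr fun i => ?_
      rcases h i with h | h <;> simp only [halfVec, h]
      · exact Or.inl (by norm_num)
      · exact Or.inr (by norm_num)
  rw [rootsF4, Finset.mem_union, mem_spin, rootsB_eq, mem_withNeg]
  constructor
  · rintro ((h | h) | h)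
    · exact Or.inl (halfRoots_subset_posF4 h)
    · exact Or.inr (halfRoots_subset_posF4 h)
    · rcases h 0 with h0 | h0
      · exact Or.inl (mem_posF4_of_spin h h0)
      · refine Or.inr (mem_posF4_of_spin (fun i => ?_) (by simp [h0]))
        rcases h i with h | h <;> simp [h]
  · rintro (h | h)
    · rcases hpos _ h with h | h
      · exact Or.inl (Or.inl h)
      · exact Or.inr h
    · rcases hpos _ h with h | h
      · exact Or.inl (Or.inr h)
      · refine Or.inr fun i => ?_
        rcases h i with h | h
        · exact Or.inr (by simpa [neg_eq_iff_eq_neg] using h)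
        · exact Or.inl (by simpa using h)

/-- A description with i ≠ j in place of i < j, as needed for permutations of the coordinates, which
do not respect the order. -/
theorem mem_rootsB_iff {N : ℕ} {β : Fin N → ℝ} : β ∈ rootsB N ↔
    (∃ i, β = e i ∨ β = -e i) ∨
      ∃ i j, i ≠ j ∧ (β = e i + e j ∨ β = e i - e j ∨ β = -(e i + e j)) := by
  rw [rootsB_eq, mem_withNeg, mem_halfRoots, mem_halfRoots]
  simp only [one_smul]
  constructor
  · rintro ((⟨i, h⟩ | ⟨i, j, hij, h | h⟩) | (⟨i, h⟩ | ⟨i, j, hij, h | h⟩))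
    · exact Or.inl ⟨i, Or.inl h⟩
    · exact Or.inr ⟨i, j, hij.ne, Or.inl h⟩
    · exact Or.inr ⟨i, j, hij.ne, Or.inr (Or.inl h)⟩
    · exact Or.inl ⟨i, Or.inr (neg_eq_iff_eq_neg.1 h)⟩
    · exact Or.inr ⟨i, j, hij.ne, Or.inr (Or.inr (neg_eq_iff_eq_neg.1 h))⟩
    · exact Or.inr ⟨j, i, hij.ne', Or.inr (Or.inl (by rw [neg_eq_iff_eq_neg.1 h, neg_sub]))⟩
  · rintro (⟨i, rfl | rfl⟩ | ⟨i, j, hij, h⟩)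
    · exact Or.inl (Or.inl ⟨i, rfl⟩)
    · exact Or.inr (Or.inl ⟨i, neg_neg _⟩)
    · rcases lt_or_gt_of_ne hij with hlt | hlt <;> rcases h with rfl | rfl | rfl
      · exact Or.inl (Or.inr ⟨i, j, hlt, Or.inl rfl⟩)
      · exact Or.inl (Or.inr ⟨i, j, hlt, Or.inr rfl⟩)
      · exact Or.inr (Or.inr ⟨i, j, hlt, Or.inl (neg_neg _)⟩)
      · exact Or.inl (Or.inr ⟨j, i, hlt, Or.inl (add_comm _ _)⟩)
      · exact Or.inr (Or.inr ⟨j, i, hlt, Or.inr (neg_sub _ _)⟩)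
      · exact Or.inr (Or.inr ⟨j, i, hlt, Or.inl (by rw [neg_neg, add_comm])⟩)

theorem comp_mem_rootsF4 {β : Fin 4 → ℝ} (h : β ∈ rootsF4) (σ : Equiv.Perm (Fin 4)) :
    β ∘ σ ∈ rootsF4 := by
  have he : ∀ i : Fin 4, (e i : Fin 4 → ℝ) ∘ σ = e (σ.symm i) := by
    intro i
    ext j
    simp only [Function.comp, e_apply, Equiv.eq_symm_apply]
  rw [rootsF4, Finset.mem_union, mem_spin, mem_rootsB_iff] at h ⊢
  rcases h with (⟨i, h | h⟩ | ⟨i, j, hij, h⟩) | h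
  · exact Or.inl (Or.inl ⟨σ.symm i, Or.inl (by rw [h, he])⟩)
  · exact Or.inl (Or.inl ⟨σ.symm i, Or.inr (by rw [h, ← he]; rfl)⟩)
  · refine Or.inl (Or.inr ⟨σ.symm i, σ.symm j, σ.symm.injective.ne hij, ?_⟩)
    rw [← he, ← he]
    rcases h with h | h | h
    · exact Or.inl (by rw [h]; rfl)
    · exact Or.inr (Or.inl (by rw [h]; rfl))
    · exact Or.inr (Or.inr (by rw [h]; rfl))
  · exact Or.inr fun i => h (σ i)

/-- A sum of an even function over a root system in terms of the positive roots. -/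
theorem sum_eq_two_mul_sum_pos {N : ℕ} {R P : Finset (Fin N → ℝ)} {x₀ : Fin N → ℝ}
    (hR : ∀ β, β ∈ R ↔ β ∈ P ∨ -β ∈ P) (hx₀ : ∀ β ∈ P, 0 < β ⬝ᵥ x₀)
    (f : (Fin N → ℝ) → ℂ) (hf : ∀ β, f (-β) = f β) : ∑ β ∈ R, f β = 2 * ∑ β ∈ P, f β := by
  classical
  have h1 : R = P ∪ P.image Neg.neg := by
    ext β
    rw [hR, Finset.mem_union, Finset.mem_image]
    refine or_congr_right ⟨fun h => ⟨_, h, neg_neg β⟩, ?_⟩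
    rintro ⟨δ, h, rfl⟩
    rwa [neg_neg]
  rw [h1, Finset.sum_union, Finset.sum_image neg_injective.injOn, two_mul]
  · simp only [hf]
  · rw [Finset.disjoint_left]
    intro β hβ hβ'
    obtain ⟨δ, h, rfl⟩ := Finset.mem_image.1 hβ'
    have h2 := hx₀ _ hβ
    rw [neg_dotProduct] at h2
    linarith [hx₀ _ h]

theorem weight_neg {N : ℕ} (R : Finset (Fin N → ℝ)) (p q : ℂ) (β : Fin N → ℝ) :
    weight R p q (-β) = weight R p q β := by
  simp [weight, mult]

theorem comp_dotProduct_comp {N : ℕ} (σ : Equiv.Perm (Fin N)) (β : Fin N → ℝ) :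
    (β ∘ σ) ⬝ᵥ (β ∘ σ) = β ⬝ᵥ β :=
  Equiv.sum_comp σ fun i => β i * β i

theorem pair_comp_comp {N : ℕ} (σ : Equiv.Perm (Fin N)) (β : Fin N → ℝ) (x : Fin N → ℂ) :
    pair (β ∘ σ) (x ∘ σ) = pair β x :=
  Equiv.sum_comp σ fun i => (β i : ℂ) * x i

/-- Equivariance of the structure constants under permutations of the coordinates. -/
theorem structMatrix_comp_perm {N : ℕ} {R P : Finset (Fin N → ℝ)} {x₀ : Fin N → ℝ}
    (hR : ∀ β, β ∈ R ↔ β ∈ P ∨ -β ∈ P) (hx₀ : ∀ β ∈ P, 0 < β ⬝ᵥ x₀) (p q : ℂ)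
    {σ : Equiv.Perm (Fin N)} (hσ : ∀ β ∈ R, β ∘ σ ∈ R) (hσ' : ∀ β ∈ R, β ∘ σ.symm ∈ R)
    (x : Fin N → ℂ) (i j k : Fin N) :
    structMatrix R P p q (x ∘ σ) (Pi.single i 1) j k =
      structMatrix R P p q x (Pi.single (σ i) 1) (σ j) (σ k) := by
  rw [structMatrix_single_apply, structMatrix_single_apply]
  -- A permutation preserves R but not P. The summand is even in β (three coordinates and one coth),
  -- so twice the sum over P is the sum over R, which can be reindexed.
  refine mul_left_cancel₀ (two_ne_zero (α := ℂ)) ?_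
  rw [← sum_eq_two_mul_sum_pos hR hx₀, ← sum_eq_two_mul_sum_pos hR hx₀]
  · refine (Finset.sum_bij' (fun β _ => β ∘ σ) (fun β _ => β ∘ σ.symm) hσ hσ' ?_ ?_ ?_).symm
    · intro β _
      ext i; simp
    · intro β _
      ext i; simp
    · intro β _
      simp only [pair_comp_comp, weight, mult, comp_dotProduct_comp, Function.comp]
  · intro β
    rw [weight_neg, pair_neg, coth_neg]
    simp
  · intro β
    rw [weight_neg, pair_neg, coth_neg]
    simp

/-! ### Commutators for F_4. -/

theorem doubledF4_norm : ∀ v ∈ doubledF4, v ⬝ᵥ v = 4 ∨ v ⬝ᵥ v = 8 := by decide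

theorem weight_rootsF4 (p q : ℂ) {v : Fin 4 → ℤ} (hv : v ∈ doubledF4) :
    weight rootsF4 p q (halfVec v) = if v ⬝ᵥ v = 4 then p else q / 2 := by
  have h1 : ∀ δ ∈ rootsF4, (1 : ℝ) ≤ δ ⬝ᵥ δ := by
    have : ∀ δ ∈ posF4, (1 : ℝ) ≤ δ ⬝ᵥ δ := by
      intro δ hδ
      obtain ⟨w, hw, rfl⟩ := mem_posF4.1 hδ
      rw [halfVec_dotProduct]
      rcases doubledF4_norm w hw with h | h <;> rw [h] <;> norm_num
    intro δ hδ
    rcases mem_rootsF4_iff.1 hδ with h | h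
    · exact this δ h
    · simpa using this _ h
  rcases doubledF4_norm v hv with h | h
  · have h2 : halfVec v ⬝ᵥ halfVec v = 1 := by rw [halfVec_dotProduct, h]; norm_num
    rw [if_pos h, weight_of_minimal (by rwa [h2]), h2]
    simp
  · have h2 : halfVec v ⬝ᵥ halfVec v = 2 := by rw [halfVec_dotProduct, h]; norm_num
    have h3 : halfVec ![2, 0, 0, 0] ∈ rootsF4 :=
      mem_rootsF4_iff.2 (Or.inl (mem_posF4.2 ⟨_, by decide, rfl⟩))
    have h4 : halfVec ![2, 0, 0, 0] ⬝ᵥ halfVec ![2, 0, 0, 0] = (1 : ℝ) := by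
      rw [halfVec_dotProduct, show (![2, 0, 0, 0] : Fin 4 → ℤ) ⬝ᵥ ![2, 0, 0, 0] = 4 by decide]
      norm_num
    rw [if_neg (by rw [h]; decide), weight_of_not_minimal h3 (by rw [h2, h4]; norm_num), h2]
    simp

/-- The value of `coth` at the half of an integer combination of four coordinates. -/
def coth4 (x : Fin 4 → ℂ) (a b c d : ℤ) : ℂ :=
  coth ((a * x 0 + b * x 1 + c * x 2 + d * x 3) / 2)

theorem pair_halfVec (x : Fin 4 → ℂ) (v : Fin 4 → ℤ) :
    pair (halfVec v) x = (v 0 * x 0 + v 1 * x 1 + v 2 * x 2 + v 3 * x 3) / 2 := by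
  simp only [pair, cvec, halfVec, dotProduct, Fin.sum_univ_four]
  push_cast
  ring

/-- The contribution of one root to the structure constants. -/
def rootTerm (x : Fin 4 → ℂ) (i j k : Fin 4) (w : ℂ) (a b c d : ℤ) : ℂ :=
  w * ((![a, b, c, d] i * ![a, b, c, d] j * ![a, b, c, d] k : ℤ) / 8) * coth4 x a b c d

theorem structMatrix_posF4 (p q : ℂ) (x : Fin 4 → ℂ) (i j k : Fin 4) :
    structMatrix rootsF4 posF4 p q x (Pi.single i 1) j k =
      rootTerm x i j k p 2 0 0 0 + rootTerm x i j k p 0 2 0 0 + rootTerm x i j k p 0 0 2 0 +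
      rootTerm x i j k p 0 0 0 2 +
      rootTerm x i j k (q / 2) 2 2 0 0 + rootTerm x i j k (q / 2) 2 (-2) 0 0 +
      rootTerm x i j k (q / 2) 2 0 2 0 + rootTerm x i j k (q / 2) 2 0 (-2) 0 +
      rootTerm x i j k (q / 2) 2 0 0 2 + rootTerm x i j k (q / 2) 2 0 0 (-2) +
      rootTerm x i j k (q / 2) 0 2 2 0 + rootTerm x i j k (q / 2) 0 2 (-2) 0 +
      rootTerm x i j k (q / 2) 0 2 0 2 + rootTerm x i j k (q / 2) 0 2 0 (-2) +
      rootTerm x i j k (q / 2) 0 0 2 2 + rootTerm x i j k (q / 2) 0 0 2 (-2) +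
      rootTerm x i j k p 1 1 1 1 + rootTerm x i j k p 1 1 1 (-1) +
      rootTerm x i j k p 1 1 (-1) 1 + rootTerm x i j k p 1 1 (-1) (-1) +
      rootTerm x i j k p 1 (-1) 1 1 + rootTerm x i j k p 1 (-1) 1 (-1) +
      rootTerm x i j k p 1 (-1) (-1) 1 + rootTerm x i j k p 1 (-1) (-1) (-1) := by
  rw [structMatrix_single_apply, sum_posF4]
  have h : ∀ v ∈ doubledF4, weight rootsF4 p q (halfVec v) * (halfVec v i : ℝ) *
      (halfVec v j : ℝ) * (halfVec v k : ℝ) * coth (pair (halfVec v) x) =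
      rootTerm x i j k (if v ⬝ᵥ v = 4 then p else q / 2) (v 0) (v 1) (v 2) (v 3) := by
    intro v hv
    have hv4 : ![v 0, v 1, v 2, v 3] = v := by
      ext i; fin_cases i <;> rfl
    rw [weight_rootsF4 p q hv, pair_halfVec, rootTerm, coth4, hv4]
    simp only [halfVec]
    push_cast
    ring
  rw [Finset.sum_congr rfl h]
  have hsum : ∀ f : (Fin 4 → ℤ) → ℂ, ∑ v ∈ doubledF4, f v = (doubledF4.val.map f).sum :=
    fun f => rfl
  rw [hsum, doubledF4]
  simp only [Multiset.map_coe, Multiset.sum_coe, List.map_cons, List.map_nil, List.sum_cons,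
    List.sum_nil]
  simp [dotProduct, Fin.sum_univ_four, add_assoc]

/-- Normalized to have right-hand side 1, so that in a linear combination of such relations the
constant is the sum of the coefficients. -/
theorem coth4_add_mul {x : Fin 4 → ℂ} (hx : IsRegular posF4 x)
    (a b c d a' b' c' d' a'' b'' c'' d'' : ℤ)
    (h : (![a, b, c, d] ∈ doubledF4 ∧ ![a', b', c', d'] ∈ doubledF4 ∧
      ![a'', b'', c'', d''] ∈ doubledF4) ∧ a'' = a + a' ∧ b'' = b + b' ∧ c'' = c + c' ∧
      d'' = d + d' := by decide) :
    coth4 x a'' b'' c'' d'' * (coth4 x a b c d + coth4 x a' b' c' d') -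
      coth4 x a b c d * coth4 x a' b' c' d' = 1 := by
  have hs : ∀ a b c d : ℤ, ![a, b, c, d] ∈ doubledF4 →
      Complex.sinh ((a * x 0 + b * x 1 + c * x 2 + d * x 3) / 2) ≠ 0 := by
    intro a b c d hv
    have := hx _ (mem_posF4.2 ⟨_, hv, rfl⟩)
    rwa [pair_halfVec] at this
  obtain ⟨h, rfl, rfl, rfl, rfl⟩ := h
  have := coth_add_mul (hs _ _ _ _ h.1) (hs _ _ _ _ h.2.1) (hs _ _ _ _ h.2.2)
    (by push_cast; ring)
  rw [coth4, coth4, coth4, this]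
  ring

-- Orthogonal pairs of roots do not contribute. Each plane of type A_2 needs one triple β + δ; each
-- plane of type B_2 needs two, between which the product of the two orthogonal short roots cancels.
set_option maxHeartbeats 1000000 in
theorem commutator_posF4_diag (p q : ℂ) {x : Fin 4 → ℂ} (hx : IsRegular posF4 x) :
    (structMatrix rootsF4 posF4 p q x (Pi.single 0 1) *
      structMatrix rootsF4 posF4 p q x (Pi.single 1 1) -
      structMatrix rootsF4 posF4 p q x (Pi.single 1 1) *
      structMatrix rootsF4 posF4 p q x (Pi.single 0 1)) 0 1 = 3 * p * q + p ^ 2 + 2 * q ^ 2 := by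
  have T := @coth4_add_mul x hx
  simp only [Matrix.sub_apply, Matrix.mul_apply, Fin.sum_univ_four, structMatrix_posF4, rootTerm]
  simp
  -- The coefficient of a triple is ± d_β d_δ ⟨β,δ⟩ times the squared (0,1) minor, read off from a
  -- non-orthogonal pair in it; the coefficients add up to 3pq + p² + 2q².
  linear_combination
    p * q / 2 * T 2 0 0 0 0 2 0 0 2 2 0 0 + p * q / 2 * T 0 2 0 0 2 (-2) 0 0 2 0 0 0
    + p ^ 2 / 8 * T 0 2 0 0 1 (-1) 1 1 1 1 1 1 + p ^ 2 / 8 * T 0 2 0 0 1 (-1) 1 (-1) 1 1 1 (-1)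
    + p ^ 2 / 8 * T 0 2 0 0 1 (-1) (-1) 1 1 1 (-1) 1
    + p ^ 2 / 8 * T 0 2 0 0 1 (-1) (-1) (-1) 1 1 (-1) (-1)
    + q ^ 2 / 4 * T 2 (-2) 0 0 0 2 2 0 2 0 2 0 + q ^ 2 / 4 * T 2 (-2) 0 0 0 2 (-2) 0 2 0 (-2) 0
    + q ^ 2 / 4 * T 2 (-2) 0 0 0 2 0 2 2 0 0 2 + q ^ 2 / 4 * T 2 (-2) 0 0 0 2 0 (-2) 2 0 0 (-2)
    + q ^ 2 / 4 * T 2 0 2 0 0 2 (-2) 0 2 2 0 0 + q ^ 2 / 4 * T 2 0 (-2) 0 0 2 2 0 2 2 0 0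
    + q ^ 2 / 4 * T 2 0 0 2 0 2 0 (-2) 2 2 0 0 + q ^ 2 / 4 * T 2 0 0 (-2) 0 2 0 2 2 2 0 0
    + p * q / 8 * T 0 2 2 0 1 (-1) (-1) 1 1 1 1 1
    + p * q / 8 * T 0 2 2 0 1 (-1) (-1) (-1) 1 1 1 (-1)
    + p * q / 8 * T 0 2 (-2) 0 1 (-1) 1 1 1 1 (-1) 1
    + p * q / 8 * T 0 2 (-2) 0 1 (-1) 1 (-1) 1 1 (-1) (-1)
    + p * q / 8 * T 0 2 0 2 1 (-1) 1 (-1) 1 1 1 1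
    + p * q / 8 * T 0 2 0 2 1 (-1) (-1) (-1) 1 1 (-1) 1
    + p * q / 8 * T 0 2 0 (-2) 1 (-1) 1 1 1 1 1 (-1)
    + p * q / 8 * T 0 2 0 (-2) 1 (-1) (-1) 1 1 1 (-1) (-1)
    + p * q / 8 * T 1 1 1 1 1 (-1) 1 (-1) 2 0 2 0 + p * q / 8 * T 1 1 1 1 1 (-1) (-1) 1 2 0 0 2
    + p ^ 2 / 8 * T 1 1 1 1 1 (-1) (-1) (-1) 2 0 0 0 + p * q / 8 * T 1 1 1 (-1) 1 (-1) 1 1 2 0 2 0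
    + p ^ 2 / 8 * T 1 1 1 (-1) 1 (-1) (-1) 1 2 0 0 0
    + p * q / 8 * T 1 1 1 (-1) 1 (-1) (-1) (-1) 2 0 0 (-2)
    + p * q / 8 * T 1 1 (-1) 1 1 (-1) 1 1 2 0 0 2 + p ^ 2 / 8 * T 1 1 (-1) 1 1 (-1) 1 (-1) 2 0 0 0
    + p * q / 8 * T 1 1 (-1) 1 1 (-1) (-1) (-1) 2 0 (-2) 0
    + p ^ 2 / 8 * T 1 1 (-1) (-1) 1 (-1) 1 1 2 0 0 0
    + p * q / 8 * T 1 1 (-1) (-1) 1 (-1) 1 (-1) 2 0 0 (-2)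
    + p * q / 8 * T 1 1 (-1) (-1) 1 (-1) (-1) 1 2 0 (-2) 0

-- Now the weight of a triple is a product of the (0,1) and (0,2) minors, which can have either
-- sign, and the coefficients add up to 0.
set_option maxHeartbeats 1000000 in
theorem commutator_posF4_adjacent (p q : ℂ) {x : Fin 4 → ℂ} (hx : IsRegular posF4 x) :
    (structMatrix rootsF4 posF4 p q x (Pi.single 0 1) *
      structMatrix rootsF4 posF4 p q x (Pi.single 1 1) -
      structMatrix rootsF4 posF4 p q x (Pi.single 1 1) *
      structMatrix rootsF4 posF4 p q x (Pi.single 0 1)) 0 2 = 0 := by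
  have T := @coth4_add_mul x hx
  simp only [Matrix.sub_apply, Matrix.mul_apply, Fin.sum_univ_four, structMatrix_posF4, rootTerm]
  simp
  linear_combination
    q ^ 2 / 4 * T 2 (-2) 0 0 0 2 2 0 2 0 2 0 - q ^ 2 / 4 * T 2 (-2) 0 0 0 2 (-2) 0 2 0 (-2) 0
    - q ^ 2 / 4 * T 2 0 2 0 0 2 (-2) 0 2 2 0 0 + q ^ 2 / 4 * T 2 0 (-2) 0 0 2 2 0 2 2 0 0
    + p * q / 8 * T 0 2 2 0 1 (-1) (-1) 1 1 1 1 1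
    + p * q / 8 * T 0 2 2 0 1 (-1) (-1) (-1) 1 1 1 (-1)
    - p * q / 8 * T 0 2 (-2) 0 1 (-1) 1 1 1 1 (-1) 1
    - p * q / 8 * T 0 2 (-2) 0 1 (-1) 1 (-1) 1 1 (-1) (-1)
    + p * q / 8 * T 1 1 1 1 1 (-1) (-1) 1 2 0 0 2 + p ^ 2 / 8 * T 1 1 1 1 1 (-1) (-1) (-1) 2 0 0 0
    + p ^ 2 / 8 * T 1 1 1 (-1) 1 (-1) (-1) 1 2 0 0 0
    + p * q / 8 * T 1 1 1 (-1) 1 (-1) (-1) (-1) 2 0 0 (-2)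
    - p * q / 8 * T 1 1 (-1) 1 1 (-1) 1 1 2 0 0 2 - p ^ 2 / 8 * T 1 1 (-1) 1 1 (-1) 1 (-1) 2 0 0 0
    - p ^ 2 / 8 * T 1 1 (-1) (-1) 1 (-1) 1 1 2 0 0 0
    - p * q / 8 * T 1 1 (-1) (-1) 1 (-1) 1 (-1) 2 0 0 (-2)

-- Only triples mixing short and long roots survive: in each A_2 plane the (0,1) or the (2,3) minor
-- vanishes. The remaining coefficients add up to 0.
set_option maxHeartbeats 1000000 in
theorem commutator_posF4_disjoint (p q : ℂ) {x : Fin 4 → ℂ} (hx : IsRegular posF4 x) :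
    (structMatrix rootsF4 posF4 p q x (Pi.single 0 1) *
      structMatrix rootsF4 posF4 p q x (Pi.single 1 1) -
      structMatrix rootsF4 posF4 p q x (Pi.single 1 1) *
      structMatrix rootsF4 posF4 p q x (Pi.single 0 1)) 2 3 = 0 := by
  have T := @coth4_add_mul x hx
  simp only [Matrix.sub_apply, Matrix.mul_apply, Fin.sum_univ_four, structMatrix_posF4, rootTerm]
  simp
  linear_combination
    -p * q / 8 * T 0 2 2 0 1 (-1) (-1) 1 1 1 1 1
    + p * q / 8 * T 0 2 2 0 1 (-1) (-1) (-1) 1 1 1 (-1)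
    + p * q / 8 * T 0 2 (-2) 0 1 (-1) 1 1 1 1 (-1) 1
    - p * q / 8 * T 0 2 (-2) 0 1 (-1) 1 (-1) 1 1 (-1) (-1)
    + p * q / 8 * T 0 2 0 2 1 (-1) 1 (-1) 1 1 1 1
    - p * q / 8 * T 0 2 0 2 1 (-1) (-1) (-1) 1 1 (-1) 1
    - p * q / 8 * T 0 2 0 (-2) 1 (-1) 1 1 1 1 1 (-1)
    + p * q / 8 * T 0 2 0 (-2) 1 (-1) (-1) 1 1 1 (-1) (-1)
    + p * q / 8 * T 1 1 1 1 1 (-1) 1 (-1) 2 0 2 0 - p * q / 8 * T 1 1 1 1 1 (-1) (-1) 1 2 0 0 2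
    - p * q / 8 * T 1 1 1 (-1) 1 (-1) 1 1 2 0 2 0
    + p * q / 8 * T 1 1 1 (-1) 1 (-1) (-1) (-1) 2 0 0 (-2)
    + p * q / 8 * T 1 1 (-1) 1 1 (-1) 1 1 2 0 0 2
    - p * q / 8 * T 1 1 (-1) 1 1 (-1) (-1) (-1) 2 0 (-2) 0
    - p * q / 8 * T 1 1 (-1) (-1) 1 (-1) 1 (-1) 2 0 0 (-2)
    + p * q / 8 * T 1 1 (-1) (-1) 1 (-1) (-1) 1 2 0 (-2) 0

theorem isSymm_structMatrix {N : ℕ} (R P : Finset (Fin N → ℝ)) (p q : ℂ) (x : Fin N → ℂ)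
    (i j k : Fin N) : structMatrix R P p q x (Pi.single i 1) j k =
      structMatrix R P p q x (Pi.single i 1) k j := by
  rw [structMatrix_single_apply, structMatrix_single_apply]
  exact Finset.sum_congr rfl fun β _ => by ring

/-- The commutator of two symmetric matrices is antisymmetric. -/
theorem commutator_transpose {N : ℕ} (R P : Finset (Fin N → ℝ)) (p q : ℂ) (x : Fin N → ℂ)
    (i j a b : Fin N) :
    (structMatrix R P p q x (Pi.single i 1) * structMatrix R P p q x (Pi.single j 1) -
      structMatrix R P p q x (Pi.single j 1) * structMatrix R P p q x (Pi.single i 1)) b a =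
    -(structMatrix R P p q x (Pi.single i 1) * structMatrix R P p q x (Pi.single j 1) -
      structMatrix R P p q x (Pi.single j 1) * structMatrix R P p q x (Pi.single i 1)) a b := by
  simp only [Matrix.sub_apply, Matrix.mul_apply, neg_sub]
  congr 1 <;> refine Finset.sum_congr rfl fun m _ => ?_ <;>
  rw [isSymm_structMatrix _ _ _ _ _ _ b m, isSymm_structMatrix _ _ _ _ _ _ m a, mul_comm]

theorem posF4_dotProduct_pos {β : Fin 4 → ℝ} (h : β ∈ posF4) :
    0 < β ⬝ᵥ halfVec ![16, 6, 4, 2] := by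
  obtain ⟨v, hv, rfl⟩ := mem_posF4.1 h
  rw [halfVec_dotProduct]
  have key : ∀ v ∈ doubledF4, 0 < v ⬝ᵥ ![16, 6, 4, 2] := by decide
  have : (0 : ℝ) < ((v ⬝ᵥ ![16, 6, 4, 2] : ℤ) : ℝ) := Int.cast_pos.2 (key v hv)
  linarith

/-- A permutation may carry a positive root to a negative one; as sinh is odd, non-vanishing is
unaffected. -/
theorem IsRegular.comp_perm {x : Fin 4 → ℂ} (hx : IsRegular posF4 x) (σ : Equiv.Perm (Fin 4)) :
    IsRegular posF4 (x ∘ σ) := by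
  intro β hβ
  have h1 : β ∘ σ.symm ∈ rootsF4 := comp_mem_rootsF4 (mem_rootsF4_iff.2 (Or.inl hβ)) _
  have h2 : pair β (x ∘ σ) = pair (β ∘ σ.symm) x := by
    rw [← pair_comp_comp σ (β ∘ σ.symm) x]
    congr 1
    ext i; simp
  rw [h2]
  rcases mem_rootsF4_iff.1 h1 with h | h
  · exact hx _ h
  · have := hx _ h
    rw [pair_neg, Complex.sinh_neg] at this
    exact neg_ne_zero.1 this

theorem commutator_posF4_comp_perm (p q : ℂ) (x : Fin 4 → ℂ) (σ : Equiv.Perm (Fin 4))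
    (i j a b : Fin 4) :
    (structMatrix rootsF4 posF4 p q (x ∘ σ) (Pi.single i 1) *
      structMatrix rootsF4 posF4 p q (x ∘ σ) (Pi.single j 1) -
      structMatrix rootsF4 posF4 p q (x ∘ σ) (Pi.single j 1) *
      structMatrix rootsF4 posF4 p q (x ∘ σ) (Pi.single i 1)) a b =
    (structMatrix rootsF4 posF4 p q x (Pi.single (σ i) 1) *
      structMatrix rootsF4 posF4 p q x (Pi.single (σ j) 1) -
      structMatrix rootsF4 posF4 p q x (Pi.single (σ j) 1) *
      structMatrix rootsF4 posF4 p q x (Pi.single (σ i) 1)) (σ a) (σ b) := by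
  have h := structMatrix_comp_perm (fun β => mem_rootsF4_iff) (fun β => posF4_dotProduct_pos) p q
    (fun β hβ => comp_mem_rootsF4 hβ σ) (fun β hβ => comp_mem_rootsF4 hβ σ.symm) x
  simp only [Matrix.sub_apply, Matrix.mul_apply, h]
  congr 1
  · exact Equiv.sum_comp σ fun m => structMatrix rootsF4 posF4 p q x (Pi.single (σ i) 1) (σ a) m *
      structMatrix rootsF4 posF4 p q x (Pi.single (σ j) 1) m (σ b)
  · exact Equiv.sum_comp σ fun m => structMatrix rootsF4 posF4 p q x (Pi.single (σ j) 1) (σ a) m *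
      structMatrix rootsF4 posF4 p q x (Pi.single (σ i) 1) m (σ b)

theorem exists_perm_of_distinct {i j k l : Fin 4} (hij : i ≠ j) (hik : i ≠ k) (hil : i ≠ l)
    (hjk : j ≠ k) (hjl : j ≠ l) (hkl : k ≠ l) :
    ∃ σ : Equiv.Perm (Fin 4), σ 0 = i ∧ σ 1 = j ∧ σ 2 = k ∧ σ 3 = l := by
  have hinj : Function.Injective ![i, j, k, l] := by
    intro a b hab
    fin_cases a <;> fin_cases b <;> simp_all
  exact ⟨Equiv.ofBijective _ (Finite.injective_iff_bijective.1 hinj), rfl, rfl, rfl, rfl⟩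

theorem exists_fourth (i j k : Fin 4) : ∃ l, i ≠ l ∧ j ≠ l ∧ k ≠ l := by
  revert i j k; decide

/-- By antisymmetry in (i, j) and in (a, b), and by transitivity of the permutations on ordered
quadruples of distinct indices, an entry depends only on how {i, j} meets {a, b}: in two, one or no
elements, the three cases computed above. -/
theorem hasCurvature_rootsF4 (p q : ℂ) {x : Fin 4 → ℂ} (hx : IsRegular posF4 x) :
    HasCurvature rootsF4 posF4 p q x (3 * p * q + p ^ 2 + 2 * q ^ 2) := by
  let F : Fin 4 → Fin 4 → Matrix (Fin 4) (Fin 4) ℂ := fun i j =>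
    structMatrix rootsF4 posF4 p q x (Pi.single i 1) *
      structMatrix rootsF4 posF4 p q x (Pi.single j 1) -
    structMatrix rootsF4 posF4 p q x (Pi.single j 1) *
      structMatrix rootsF4 posF4 p q x (Pi.single i 1)
  have ht : ∀ i j a b, F i j b a = -F i j a b := commutator_transpose _ _ _ _ _
  have hs : ∀ i j, F j i = -F i j := fun i j => (neg_sub _ _).symm
  have hd : ∀ i j a, F i j a a = 0 := fun i j a => self_eq_neg.1 (ht i j a a)
  have h3 : ∀ i j k l, i ≠ j → i ≠ k → i ≠ l → j ≠ k → j ≠ l → k ≠ l →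
      F i j i j = 3 * p * q + p ^ 2 + 2 * q ^ 2 ∧ F i j i k = 0 ∧ F i j k l = 0 := by
    intro i j k l hij hik hil hjk hjl hkl
    obtain ⟨σ, rfl, rfl, rfl, rfl⟩ := exists_perm_of_distinct hij hik hil hjk hjl hkl
    have hr := hx.comp_perm σ
    exact ⟨(commutator_posF4_comp_perm p q x σ 0 1 0 1).symm.trans (commutator_posF4_diag p q hr),
      (commutator_posF4_comp_perm p q x σ 0 1 0 2).symm.trans (commutator_posF4_adjacent p q hr),
      (commutator_posF4_comp_perm p q x σ 0 1 2 3).symm.trans (commutator_posF4_disjoint p q hr)⟩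
  have h2 : ∀ i j k, i ≠ j → i ≠ k → j ≠ k →
      F i j i j = 3 * p * q + p ^ 2 + 2 * q ^ 2 ∧ F i j i k = 0 := by
    intro i j k hij hik hjk
    obtain ⟨l, hil, hjl, hkl⟩ := exists_fourth i j k
    exact ⟨(h3 i j k l hij hik hil hjk hjl hkl).1, (h3 i j k l hij hik hil hjk hjl hkl).2.1⟩
  have h1 : ∀ i j, i ≠ j → F i j i j = 3 * p * q + p ^ 2 + 2 * q ^ 2 := by
    intro i j hij
    obtain ⟨k, hik, hjk, -⟩ := exists_fourth i j j
    exact (h2 i j k hij hik hjk).1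
  have h2' : ∀ i j k, i ≠ j → i ≠ k → j ≠ k → F i j j k = 0 := by
    intro i j k hij hik hjk
    rw [hs j i, Matrix.neg_apply, (h2 j i k hij.symm hjk hik).2, neg_zero]
  intro i j hij
  ext a b
  change F i j a b = _
  simp only [Matrix.smul_apply, Matrix.sub_apply, Matrix.single_apply, smul_eq_mul]
  by_cases hab : a = b
  · subst hab
    rw [hd, if_neg (fun h => hij (h.1.trans h.2.symm)),
      if_neg (fun h => hij (h.2.trans h.1.symm)), sub_zero, mul_zero]
  by_cases hai : i = a
  · subst hai
    by_cases hbj : j = b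
    · subst hbj
      simp [h1 i j hij, hij]
    · simp [(h2 i j b hij hab hbj).2, hbj, hij.symm]
  · by_cases haj : j = a
    · subst haj
      by_cases hbi : i = b
      · subst hbi
        simp [ht i j i j, h1 i j hij, hij]
      · simp [h2' i j b hij hbi hab, hbi, hij]
    · by_cases hbi : i = b
      · subst hbi
        simp [ht i j i a, (h2 i j a hij hai haj).2, hai, haj]
      · by_cases hbj : j = b
        · subst hbj
          simp [ht i j j a, h2' i j a hij hai haj, hai, haj]
        · simp [(h3 i j a b hij hai hbi haj hbj hab).2.2, hai, haj]

/-- The doubles of the simple roots of `F_4`. -/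
def doubledSimpleF4 : Fin 4 → (Fin 4 → ℤ) :=
  ![![0, 2, -2, 0], ![0, 0, 2, -2], ![0, 0, 0, 2], ![1, -1, -1, -1]]

theorem simpleF4_eq (i : Fin 4) : simpleF4 i = halfVec (doubledSimpleF4 i) := by
  ext j
  fin_cases i <;> fin_cases j <;> simp [simpleF4, doubledSimpleF4, halfVec, neg_div]

/-- The doubles of the fundamental coweights of `F_4`. -/
def doubledCoweightF4 : Fin 4 → (Fin 4 → ℤ) :=
  ![![2, 2, 0, 0], ![4, 2, 2, 0], ![6, 2, 2, 2], ![4, 0, 0, 0]]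

theorem gammaFormula_rootsF4 (p q : ℂ) :
    GammaFormula rootsF4 simpleF4 p q (p * q) ![p ^ 2, p * q, q ^ 2, p * q] := by
  have hmem : ∀ v ∈ doubledF4, halfVec v ∈ posF4 := fun v hv => mem_posF4.2 ⟨v, hv, rfl⟩
  -- The factor 4 appears because coweights and roots are both doubled; the bounds are the
  -- coefficients of θ = e^1 + e^2 = 2α_1 + 3α_2 + 4α_3 + 2α_4.
  have key : ∀ v ∈ doubledF4, ∀ i, ∃ m ≤ (![2, 3, 4, 2] : Fin 4 → ℕ) i,
      doubledCoweightF4 i ⬝ᵥ v = 4 * m := by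
    decide
  refine gammaFormula_of_hasCurvature (by norm_num) (P := posF4)
    (fun i => halfVec (doubledCoweightF4 i)) (halfVec ![16, 6, 4, 2]) (halfVec ![2, 2, 0, 0])
    ![2, 3, 4, 2] _ ?_ (fun β => mem_rootsF4_iff) ?_ (fun β => posF4_dotProduct_pos) ?_
    (hmem _ (by decide)) ?_ ?_ (fun x hx => hasCurvature_rootsF4 p q hx) ?_
  · intro i j
    have h : ∀ i j, doubledCoweightF4 i ⬝ᵥ doubledSimpleF4 j = if i = j then 4 else 0 := by decide
    rw [simpleF4_eq, halfVec_dotProduct, h]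
    split_ifs <;> norm_num
  · intro β hβ i
    obtain ⟨v, hv, rfl⟩ := mem_posF4.1 hβ
    obtain ⟨m, -, h⟩ := key v hv i
    refine ⟨m, ?_⟩
    rw [halfVec_dotProduct, h]
    push_cast
    ring
  · intro i
    rw [simpleF4_eq]
    refine hmem _ ?_
    revert i; decide
  · intro i
    have h : ∀ i, doubledCoweightF4 i ⬝ᵥ ![2, 2, 0, 0] = 4 * (![2, 3, 4, 2] : Fin 4 → ℤ) i := by
      decide
    rw [halfVec_dotProduct, h]
    push_cast
    ring
  · intro β hβ i
    obtain ⟨v, hv, rfl⟩ := mem_posF4.1 hβ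
    obtain ⟨m, hm, h⟩ := key v hv i
    have hn : ∀ i, ((![2, 3, 4, 2] : Fin 4 → ℕ) i : ℤ) = (![2, 3, 4, 2] : Fin 4 → ℤ) i := by
      decide
    have hm' : (m : ℤ) ≤ (![2, 3, 4, 2] : Fin 4 → ℤ) i := by
      rw [← hn]; exact_mod_cast hm
    have hm'' : (m : ℝ) ≤ ((![2, 3, 4, 2] : Fin 4 → ℤ) i : ℝ) := by exact_mod_cast hm'
    rw [halfVec_dotProduct, h]
    push_cast
    linarith
  · have h : ∀ i, doubledSimpleF4 i ⬝ᵥ doubledSimpleF4 i = (![8, 8, 4, 4] : Fin 4 → ℤ) i := by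
      decide
    simp only [simpleF4_eq, halfVec_dotProduct, h,
      show (![2, 2, 0, 0] : Fin 4 → ℤ) ⬝ᵥ ![2, 2, 0, 0] = 8 by decide, Fin.sum_univ_four]
    simp
    ring

/-! ### The root system G_2 in hexagonal coordinates. -/

/-- The vector `(√3/2) a e^1 + (1/2) b e^2`. -/
def hexVec (v : ℤ × ℤ) : Fin 2 → ℝ := ![v.1 * √3 / 2, v.2 / 2]

/-- The coordinates of the positive roots of `G_2`. -/
def hexG2 : Finset (ℤ × ℤ) :=
  ⟨([(2, 0), (1, 3), (1, -3), (0, 2), (1, 1), (1, -1)] : List (ℤ × ℤ)), by decide⟩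

open Classical in
/-- The positive roots of `G_2`. -/
def posG2 : Finset (Fin 2 → ℝ) := hexG2.image hexVec

theorem hexVec_injective : Function.Injective hexVec := by
  rintro ⟨a, b⟩ ⟨c, d⟩ h
  have h0 := congrFun h 0
  have h1 := congrFun h 1
  simp [hexVec] at h0 h1
  rw [h0, h1]

theorem mem_posG2 {β : Fin 2 → ℝ} : β ∈ posG2 ↔ ∃ v ∈ hexG2, hexVec v = β := by
  rw [posG2, Finset.mem_image]

theorem hexVec_dotProduct (v w : ℤ × ℤ) :
    hexVec v ⬝ᵥ hexVec w = ((3 * (v.1 * w.1) + v.2 * w.2 : ℤ) : ℝ) / 4 := by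
  simp only [hexVec, dotProduct, Fin.sum_univ_two, Matrix.cons_val_zero, Matrix.cons_val_one]
  push_cast
  linear_combination ((v.1 : ℝ) * w.1 / 4) * Real.sq_sqrt (show (0 : ℝ) ≤ 3 by norm_num)

theorem rootsG2_eq : rootsG2 = withNeg posG2 := by
  classical
  rw [rootsG2]
  congr 1
  ext β
  rw [mem_posG2]
  simp [hexG2, hexVec, eq_comm (b := β), neg_div]

theorem mem_rootsG2_iff {β : Fin 2 → ℝ} : β ∈ rootsG2 ↔ β ∈ posG2 ∨ -β ∈ posG2 := by
  rw [rootsG2_eq, mem_withNeg]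

theorem hexG2_norm : ∀ v ∈ hexG2, 3 * (v.1 * v.1) + v.2 * v.2 = 4 ∨
    3 * (v.1 * v.1) + v.2 * v.2 = 12 := by decide

theorem weight_rootsG2 (p q : ℂ) {v : ℤ × ℤ} (hv : v ∈ hexG2) :
    weight rootsG2 p q (hexVec v) =
      if 3 * (v.1 * v.1) + v.2 * v.2 = 4 then p else q / 3 := by
  have h1 : ∀ δ ∈ rootsG2, (1 : ℝ) ≤ δ ⬝ᵥ δ := by
    have : ∀ δ ∈ posG2, (1 : ℝ) ≤ δ ⬝ᵥ δ := by
      intro δ hδ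
      obtain ⟨w, hw, rfl⟩ := mem_posG2.1 hδ
      rw [hexVec_dotProduct]
      rcases hexG2_norm w hw with h | h <;> rw [h] <;> norm_num
    intro δ hδ
    rcases mem_rootsG2_iff.1 hδ with h | h
    · exact this δ h
    · simpa using this _ h
  rcases hexG2_norm v hv with h | h
  · have h2 : hexVec v ⬝ᵥ hexVec v = 1 := by rw [hexVec_dotProduct, h]; norm_num
    rw [if_pos h, weight_of_minimal (by rwa [h2]), h2]
    simp
  · have h2 : hexVec v ⬝ᵥ hexVec v = 3 := by rw [hexVec_dotProduct, h]; norm_num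
    have h3 : hexVec (0, 2) ∈ rootsG2 :=
      mem_rootsG2_iff.2 (Or.inl (mem_posG2.2 ⟨_, by decide, rfl⟩))
    have h4 : hexVec (0, 2) ⬝ᵥ hexVec (0, 2) = (1 : ℝ) := by
      rw [hexVec_dotProduct]
      norm_num
    rw [if_neg (by rw [h]; decide), weight_of_not_minimal h3 (by rw [h2, h4]; norm_num), h2]
    simp

/-- The value of `coth` at an integer combination in the hexagonal coordinates. -/
def cothHex (x : Fin 2 → ℂ) (a b : ℤ) : ℂ :=
  coth (a * ((√3 : ℝ) * x 0 / 2) + b * (x 1 / 2))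

theorem pair_hexVec (x : Fin 2 → ℂ) (v : ℤ × ℤ) :
    pair (hexVec v) x = v.1 * ((√3 : ℝ) * x 0 / 2) + v.2 * (x 1 / 2) := by
  simp only [pair, cvec, hexVec, dotProduct, Fin.sum_univ_two, Matrix.cons_val_zero,
    Matrix.cons_val_one]
  push_cast
  ring

theorem cothHex_add_mul {x : Fin 2 → ℂ} (hx : IsRegular posG2 x) (a b a' b' a'' b'' : ℤ)
    (h : ((a, b) ∈ hexG2 ∧ (a', b') ∈ hexG2 ∧ (a'', b'') ∈ hexG2) ∧ a'' = a + a' ∧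
      b'' = b + b' := by decide) :
    cothHex x a'' b'' * (cothHex x a b + cothHex x a' b') - cothHex x a b * cothHex x a' b' =
      1 := by
  have hs : ∀ a b : ℤ, (a, b) ∈ hexG2 →
      Complex.sinh (a * ((√3 : ℝ) * x 0 / 2) + b * (x 1 / 2)) ≠ 0 := by
    intro a b hv
    have := hx _ (mem_posG2.2 ⟨_, hv, rfl⟩)
    rwa [pair_hexVec] at this
  obtain ⟨h, rfl, rfl⟩ := h
  have := coth_add_mul (hs _ _ h.1) (hs _ _ h.2.1) (hs _ _ h.2.2) (by push_cast; ring)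
  rw [cothHex, cothHex, cothHex, this]
  ring

/-- The moments `∑ d_β a^m b^n coth(β(x))` over the positive roots of `G_2` with hexagonal
coordinates `(a, b)`. -/
def hexMoment (p q : ℂ) (x : Fin 2 → ℂ) (m n : ℕ) : ℂ :=
  ∑ v ∈ hexG2, (if 3 * (v.1 * v.1) + v.2 * v.2 = 4 then p else q / 3) *
    ((v.1 ^ m * v.2 ^ n : ℤ) : ℂ) * cothHex x v.1 v.2

/-- In the plane a component of the symmetric cubic tensor depends only on how many of its indices
are the second one. Each first coordinate contributes √3/2 and each second 1/2. -/
theorem structMatrix_posG2 (p q : ℂ) (x : Fin 2 → ℂ) (i j k : Fin 2) :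
    structMatrix rootsG2 posG2 p q x (Pi.single i 1) j k =
      (√3 : ℝ) ^ (3 - (i.val + j.val + k.val)) / 8 *
        hexMoment p q x (3 - (i.val + j.val + k.val)) (i.val + j.val + k.val) := by
  rw [structMatrix_single_apply, posG2, Finset.sum_image hexVec_injective.injOn, hexMoment,
    Finset.mul_sum]
  refine Finset.sum_congr rfl fun v hv => ?_
  rw [weight_rootsG2 p q hv, pair_hexVec, cothHex]
  fin_cases i <;> fin_cases j <;> fin_cases k <;> simp [hexVec] <;> ring_nf

/-- The left side is 64 times the (0, 1) entry of [M_0, M_1], with the powers of √3 evaluated. -/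
theorem hexMoment_identity (p q : ℂ) {x : Fin 2 → ℂ} (hx : IsRegular posG2 x) :
    9 * hexMoment p q x 3 0 * hexMoment p q x 1 2 +
      3 * hexMoment p q x 2 1 * hexMoment p q x 0 3 - 9 * hexMoment p q x 2 1 ^ 2 -
      3 * hexMoment p q x 1 2 ^ 2 = 8 * (3 * p ^ 2 + 12 * p * q + 9 * q ^ 2) := by
  have T := @cothHex_add_mul x hx
  simp only [hexMoment, hexG2]
  norm_num
  -- The purely short triple occurs a second time with coefficient pq: it cancels the products of
  -- two short roots left over by the three mixed triples.
  linear_combination 24 * p ^ 2 * T 0 2 1 (-1) 1 1 +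
    24 * p * q * (T 1 (-3) 0 2 1 (-1) + T 0 2 1 1 1 3 + T 0 2 1 (-1) 1 1 + T 1 1 1 (-1) 2 0) +
    72 * q ^ 2 * T 1 3 1 (-3) 2 0

/-- In dimension two, antisymmetry leaves a single independent entry of a single commutator. -/
theorem hasCurvature_rootsG2 (p q : ℂ) {x : Fin 2 → ℂ} (hx : IsRegular posG2 x) :
    HasCurvature rootsG2 posG2 p q x ((3 * p ^ 2 + 12 * p * q + 9 * q ^ 2) / 8) := by
  have h01 : (structMatrix rootsG2 posG2 p q x (Pi.single 0 1) *
      structMatrix rootsG2 posG2 p q x (Pi.single 1 1) -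
      structMatrix rootsG2 posG2 p q x (Pi.single 1 1) *
      structMatrix rootsG2 posG2 p q x (Pi.single 0 1)) 0 1 =
      (3 * p ^ 2 + 12 * p * q + 9 * q ^ 2) / 8 := by
    have hs : ((√3 : ℝ) : ℂ) ^ 2 = 3 := by
      rw [← Complex.ofReal_pow, Real.sq_sqrt (by norm_num)]
      norm_num
    have h := hexMoment_identity p q hx
    simp only [Matrix.sub_apply, Matrix.mul_apply, Fin.sum_univ_two, structMatrix_posG2]
    norm_num
    set s : ℂ := ((√3 : ℝ) : ℂ)
    set A := hexMoment p q x 3 0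
    set B := hexMoment p q x 2 1
    set C := hexMoment p q x 1 2
    set D := hexMoment p q x 0 3
    -- The factor s² + 3 comes from s⁴ − 9 = (s² + 3)(s² − 3).
    linear_combination h / 64 + ((A * C - B ^ 2) * (s ^ 2 + 3) + (B * D - C ^ 2)) / 64 * hs
  have ht := commutator_transpose rootsG2 posG2 p q x
  have hd : ∀ i j a, (structMatrix rootsG2 posG2 p q x (Pi.single i 1) *
      structMatrix rootsG2 posG2 p q x (Pi.single j 1) -
      structMatrix rootsG2 posG2 p q x (Pi.single j 1) *
      structMatrix rootsG2 posG2 p q x (Pi.single i 1)) a a = 0 :=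
    fun i j a => self_eq_neg.1 (ht i j a a)
  have h : ∀ a b, (structMatrix rootsG2 posG2 p q x (Pi.single 0 1) *
      structMatrix rootsG2 posG2 p q x (Pi.single 1 1) -
      structMatrix rootsG2 posG2 p q x (Pi.single 1 1) *
      structMatrix rootsG2 posG2 p q x (Pi.single 0 1)) a b =
      (((3 * p ^ 2 + 12 * p * q + 9 * q ^ 2) / 8 : ℂ) •
        (Matrix.single 0 1 1 - Matrix.single 1 0 1 : Matrix (Fin 2) (Fin 2) ℂ)) a b := by
    intro a b
    fin_cases a <;> fin_cases b
    · exact (hd 0 1 0).trans (by simp)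
    · exact h01.trans (by simp)
    · exact (ht 0 1 0 1).trans (by rw [h01]; simp)
    · exact (hd 0 1 1).trans (by simp)
  intro i j hij
  ext a b
  fin_cases i <;> fin_cases j
  · exact absurd rfl hij
  · exact h a b
  · have h' := h a b
    rw [← neg_inj, ← Matrix.neg_apply, neg_sub, ← Matrix.neg_apply, ← smul_neg, neg_sub] at h'
    exact h'
  · exact absurd rfl hij

/-- The hexagonal coordinates of the simple roots of `G_2`. -/
def hexSimpleG2 : Fin 2 → ℤ × ℤ := ![(1, -3), (0, 2)]

theorem simpleG2_eq (i : Fin 2) : simpleG2 i = hexVec (hexSimpleG2 i) := by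
  ext j
  fin_cases i <;> fin_cases j <;> simp [simpleG2, hexSimpleG2, hexVec, neg_div]

/-- Three times the fundamental coweights of `G_2` in hexagonal coordinates. -/
def hexCoweightG2 : Fin 2 → ℤ × ℤ := ![(4, 0), (6, 6)]

theorem gammaFormula_rootsG2 (p q : ℂ) :
    GammaFormula rootsG2 simpleG2 p q (p ^ 2) ![p * q, q ^ 2] := by
  have hmem : ∀ v ∈ hexG2, hexVec v ∈ posG2 := fun v hv => mem_posG2.2 ⟨v, hv, rfl⟩
  -- The factor 12 is 3 for the tripled coweights times 4 for the halved coordinates; the bounds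
  -- come from θ = √3 e^1 = 2α_1 + 3α_2.
  have key : ∀ v ∈ hexG2, ∀ i, ∃ m ≤ (![2, 3] : Fin 2 → ℕ) i,
      3 * ((hexCoweightG2 i).1 * v.1) + (hexCoweightG2 i).2 * v.2 = 12 * m := by
    decide
  refine gammaFormula_of_hasCurvature le_rfl (P := posG2)
    (fun i => (1 / 3 : ℝ) • hexVec (hexCoweightG2 i)) (hexVec (4, 2)) (hexVec (2, 0))
    ![2, 3] _ ?_ (fun β => mem_rootsG2_iff) ?_ ?_ ?_
    (hmem _ (by decide)) ?_ ?_ (fun x hx => hasCurvature_rootsG2 p q hx) ?_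
  · intro i j
    have h : ∀ i j, 3 * ((hexCoweightG2 i).1 * (hexSimpleG2 j).1) +
      (hexCoweightG2 i).2 * (hexSimpleG2 j).2 = if i = j then 12 else 0 := by decide
    rw [simpleG2_eq, smul_dotProduct, hexVec_dotProduct, h]
    split_ifs <;> norm_num
  · intro β hβ i
    obtain ⟨v, hv, rfl⟩ := mem_posG2.1 hβ
    obtain ⟨m, -, h⟩ := key v hv i
    refine ⟨m, ?_⟩
    rw [smul_dotProduct, hexVec_dotProduct, h, smul_eq_mul]
    push_cast
    ring
  · intro β hβ
    obtain ⟨v, hv, rfl⟩ := mem_posG2.1 hβ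
    have h : ∀ v ∈ hexG2, 0 < 3 * (v.1 * 4) + v.2 * 2 := by decide
    rw [hexVec_dotProduct]
    exact div_pos (Int.cast_pos.2 (h v hv)) (by norm_num)
  · intro i
    rw [simpleG2_eq]
    refine hmem _ ?_
    revert i; decide
  · intro i
    have h : ∀ i, 3 * ((hexCoweightG2 i).1 * 2) + (hexCoweightG2 i).2 * 0 =
      12 * (![2, 3] : Fin 2 → ℤ) i := by decide
    rw [smul_dotProduct, hexVec_dotProduct, h, smul_eq_mul]
    push_cast
    ring
  · intro β hβ i
    obtain ⟨v, hv, rfl⟩ := mem_posG2.1 hβ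
    obtain ⟨m, hm, h⟩ := key v hv i
    have hn : ∀ i, ((![2, 3] : Fin 2 → ℕ) i : ℤ) = (![2, 3] : Fin 2 → ℤ) i := by decide
    have hm' : (m : ℤ) ≤ (![2, 3] : Fin 2 → ℤ) i := by
      rw [← hn]; exact_mod_cast hm
    have hm'' : (m : ℝ) ≤ ((![2, 3] : Fin 2 → ℤ) i : ℝ) := by exact_mod_cast hm'
    rw [smul_dotProduct, hexVec_dotProduct, h, smul_eq_mul]
    push_cast
    linarith
  · simp only [simpleG2_eq, hexVec_dotProduct, hexSimpleG2, Fin.sum_univ_two]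
    simp
    ring

end TrigWDVV

end

theorem mainTheorem10 (p q : ℂ) :
    (∀ N : ℕ, 2 ≤ N →
      TrigWDVV.GammaFormula (TrigWDVV.rootsB N) (TrigWDVV.simpleB N) p q (p * q)
        (fun i => if i.val = 0 ∨ i.val + 1 = N then p * q else q ^ 2)) ∧
    (∀ N : ℕ, 2 ≤ N →
      TrigWDVV.GammaFormula (TrigWDVV.rootsC N) (TrigWDVV.simpleC N) p q (p * q)
        (fun i => if i.val = 0 ∨ i.val + 1 = N then p * q else p ^ 2)) ∧
    TrigWDVV.GammaFormula TrigWDVV.rootsF4 TrigWDVV.simpleF4 p q (p * q)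
      ![p ^ 2, p * q, q ^ 2, p * q] ∧
    TrigWDVV.GammaFormula TrigWDVV.rootsG2 TrigWDVV.simpleG2 p q (p ^ 2) ![p * q, q ^ 2] := by
  exact ⟨fun N hN => TrigWDVV.gammaFormula_rootsB p q hN,
    fun N hN => TrigWDVV.gammaFormula_rootsC p q hN, TrigWDVV.gammaFormula_rootsF4 p q,
    TrigWDVV.gammaFormula_rootsG2 p q⟩
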